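/- For $N\ge 1$ let $\mathbb S_N$ be the set of signatures of length $N$, i.e. of $N$-tuples of integers $\nu=(\nu_1\ge\dots\ge\nu_N)$, and put $$\operatorname{Dim}_N\nu=\prod_{1\le i<j\le N}\frac{\nu_i-\nu_j-i+j}{j-i}.$$ For $N\ge2$, $\nu\in\mathbb S_N$ and $\lambda\in\mathbb S_{N-1}$, write $\lambda\prec\nu$ if $\nu_i\ge\lambda_i\ge\nu_{i+1}$ for all $i=1,\dots,N-1$, and let $\Lambda^N_{N-1}(\nu,\lambda)=\operatorname{Dim}_{N-1}\lambda/\operatorname{Dim}_N\nu$ if $\lambda\prec\nu$ and $\Lambda^N_{N-1}(\nu,\lambda)=0$ otherwise. Let $(z,z',w,w')\in\mathbb C^4$ be admissible: for every $k\in\mathbb Z$ the numbers $(z+k)(z'+k)$ and $(w+k)(w'+k)$ are real and strictly positive, and $\Re(z+z'+w+w')>-1$. For $N\ge1$ and $\nu\in\mathbb S_N$ set $$M'_{z,z',w,w'\mid N}(\nu)=\prod_{i=1}^N\frac{1}{\Gamma(z-\nu_i+i)\,\Gamma(z'-\nu_i+i)\,\Gamma(w+N+1+\nu_i-i)\,\Gamma(w'+N+1+\nu_i-i)}\cdot(\operatorname{Dim}_N\nu)^2,$$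 $$C_{z,z',w,w'\mid N}=\prod_{i=1}^N\frac{\Gamma(z+z'+w+w'+i)}{\Gamma(z+w+i)\Gamma(z+w'+i)\Gamma(z'+w+i)\Gamma(z'+w'+i)\Gamma(i)},\qquad M_{z,z',w,w'\mid N}(\nu)=\frac{M'_{z,z',w,w'\mid N}(\nu)}{C_{z,z',w,w'\mid N}}.$$ Then for every $N\ge1$ one has $M'_{z,z',w,w'\mid N}(\nu)>0$ for all $\nu\in\mathbb S_N$, and the series $\sum_{\nu\in\mathbb S_N}M'_{z,z',w,w'\mid N}(\nu)$ converges with sum $C_{z,z',w,w'\mid N}$, so that the numbers $M_{z,z',w,w'\mid N}(\nu)$ are the weights of a probability measure on $\mathbb S_N$. Moreover these probability measures form a coherent family: for every $N\ge2$ and every $\lambda\in\mathbb S_{N-1}$, $$\sum_{\nu\in\mathbb S_N}M_{z,z',w,w'\mid N}(\nu)\,\Lambda^N_{N-1}(\nu,\lambda)=M_{z,z',w,w'\mid N-1}(\lambda).$$ -/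

import Mathlib

open scoped ComplexOrder ENNReal

namespace ZW

/-- Signatures of length `N`: tuples of integers `ν₁ ≥ ν₂ ≥ ⋯ ≥ ν_N`
(with the coordinates indexed from `0` to `N - 1`). -/
def Signature (N : ℕ) : Type :=
  {ν : Fin N → ℤ // Antitone ν}

/-- Weyl's dimension formula: `Dim_N ν = ∏_{i < j} (ν_i - ν_j - i + j) / (j - i)`. -/
noncomputable def dim {N : ℕ} (ν : Signature N) : ℝ :=
  ∏ i : Fin N, ∏ j ∈ Finset.Ioi i,
    ((ν.1 i : ℝ) - (ν.1 j : ℝ) - (i : ℝ) + (j : ℝ)) / ((j : ℝ) - (i : ℝ))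

/-- `lam ≺ ν`: the signatures `ν` (of length `N + 1`) and `lam` (of length `N`) interlace,
that is, `ν_i ≥ lam_i ≥ ν_{i+1}` for every `i = 1, …, N`. -/
def Interlaced {N : ℕ} (lam : Signature N) (ν : Signature (N + 1)) : Prop :=
  ∀ i : Fin N, lam.1 i ≤ ν.1 i.castSucc ∧ ν.1 i.succ ≤ lam.1 i

open Classical in
/-- The entries of the stochastic link `Λ^{N+1}_N` from signatures of length `N + 1` to
signatures of length `N`. -/
noncomputable def link {N : ℕ} (ν : Signature (N + 1)) (lam : Signature N) : ℝ :=
  if Interlaced lam ν then dim lam / dim ν else 0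

/-- The weights of the composition `M Λ^{N+1}_N` of a probability measure `M` on the
signatures of length `N + 1` with the link. -/
noncomputable def compLink {N : ℕ} (M : PMF (Signature (N + 1))) (lam : Signature N) : ℝ≥0∞ :=
  ∑' ν : Signature (N + 1), M ν * ENNReal.ofReal (link ν lam)

/-- A family of probability measures `M_N` on the signatures of length `N` (only the members
with `N ≥ 1` matter) is coherent if `M_{N+1} Λ^{N+1}_N = M_N` for every `N ≥ 1`. -/
def IsCoherent (M : (N : ℕ) → PMF (Signature N)) : Prop :=
  ∀ N : ℕ, 1 ≤ N → ∀ lam : Signature N, compLink (M (N + 1)) lam = M N lam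

/-- Admissible quadruples of complex parameters. A complex number is positive, `0 < c`, when
it is real and positive. -/
structure Admissible (z z' w w' : ℂ) : Prop where
  pos_z : ∀ k : ℤ, 0 < (z + k) * (z' + k)
  pos_w : ∀ k : ℤ, 0 < (w + k) * (w' + k)
  re_sum : -1 < (z + z' + w + w').re

/-- The unnormalized weight `M'_{z,z',w,w'|N}(ν)`. The product index `i` runs from `0` to
`N - 1`, and the index of the coordinate in the usual numbering is `i + 1`. -/
noncomputable def zwWeight' (z z' w w' : ℂ) (N : ℕ) (ν : Signature N) : ℂ :=
  (∏ i : Fin N,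
    (1 / (Complex.Gamma (z - (ν.1 i : ℂ) + ((i : ℂ) + 1)) *
          Complex.Gamma (z' - (ν.1 i : ℂ) + ((i : ℂ) + 1)))) *
    (1 / (Complex.Gamma (w + (N : ℂ) + 1 + (ν.1 i : ℂ) - ((i : ℂ) + 1)) *
          Complex.Gamma (w' + (N : ℂ) + 1 + (ν.1 i : ℂ) - ((i : ℂ) + 1))))) *
  ((dim ν : ℝ) : ℂ) ^ 2

/-- The normalizing constant `C_{z,z',w,w'|N}`. -/
noncomputable def zwConst (z z' w w' : ℂ) (N : ℕ) : ℂ :=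
  ∏ i ∈ Finset.Icc 1 N,
    Complex.Gamma (z + z' + w + w' + (i : ℂ)) /
      (Complex.Gamma (z + w + (i : ℂ)) * Complex.Gamma (z + w' + (i : ℂ)) *
        Complex.Gamma (z' + w + (i : ℂ)) * Complex.Gamma (z' + w' + (i : ℂ)) *
        Complex.Gamma (i : ℂ))

/-- The normalized weight `M_{z,z',w,w'|N}(ν) = M'_{z,z',w,w'|N}(ν) / C_{z,z',w,w'|N}`. -/
noncomputable def zwWeight (z z' w w' : ℂ) (N : ℕ) (ν : Signature N) : ℂ :=
  zwWeight' z z' w w' N ν / zwConst z z' w w' N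

end ZW

namespace ZW

open Filter Topology Asymptotics

/-! ### Asymptotics of the Gamma function along arithmetic progressions -/

/-! Put x_i = i - ν_i with i counted from 0. Then dim ν is the Vandermonde determinant V(x) up to a
constant, and the weight is V(x)² times a product of one-variable kernels `kern`, up to a constant.
Multiplying by the link to λ cancels one Vandermonde factor, so coherence reduces to summing ∏
kern(x_i) · V(x) over all x interlacing with y, the configuration of λ (`hasSum_interlacing`).

For that sum, write V(x) with monic polynomials p_j chosen so that p_0 = 1 and, for j ≥ 1, kern ·
p_j is a discrete difference of the kernel with b, b' lowered by 1 times a polynomial. The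
interlacing sum becomes a determinant of sums over consecutive intervals, and row operations replace
these by cumulative sums. The last row consists of sums over all of ℤ, which telescope to 0 except
in column 0. The minor that remains is again a product of kernels times V(y), with exactly the
parameters of level N - 1. Hence M'_N Λ = (C_N / C_{N-1}) M'_{N-1}.

The remaining entry ∑ kern is Dougall's bilateral sum (`hasSum_kern`). A contiguous relation, itself
a telescoping sum, makes the ratio of its two sides invariant under unit shifts. Sending a and b to
infinity together shows that the ratio does not depend on a, b; by symmetry it does not depend on
a', b' either, so it is a constant, evaluated from the trivial case a = a' = b = b' = 1.

The links are stochastic (`hasSum_link`), so Tonelli turns the one-step identity into a recursion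
for the total mass, starting from 1 at N = 0. Positivity comes from admissibility
(`inv_Gamma_mul_inv_Gamma_pos`). -/

lemma Gamma_add_natCast_succ (s : ℂ) (hs : ∀ m : ℕ, s ≠ -m) (n : ℕ) :
    Complex.Gamma (s + n) = (∏ j ∈ Finset.range n, (s + j)) * Complex.Gamma s := by
  induction n with
  | zero => simp
  | succ n ih =>
    have h0 : s + n ≠ 0 := fun h => hs n (eq_neg_of_add_eq_zero_left h)
    rw [Nat.cast_succ, ← add_assoc, Complex.Gamma_add_one _ h0, ih, Finset.prod_range_succ]
    ring

lemma tendsto_add_natCast_div_natCast (b : ℂ) :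
    Tendsto (fun n : ℕ => (b + n) / (n : ℂ)) atTop (𝓝 1) := by
  have h : Tendsto (fun n : ℕ => b / (n : ℂ) + 1) atTop (𝓝 (0 + 1)) :=
    (tendsto_const_div_atTop_nhds_zero_nat b).add_const 1
  rw [zero_add] at h
  refine h.congr' ?_
  filter_upwards [eventually_ne_atTop 0] with n hn
  have : (n : ℂ) ≠ 0 := Nat.cast_ne_zero.mpr hn
  field_simp

/-- `n ^ (b - 1) n! / Γ(b + n) → 1` for every complex `b`. -/
lemma tendsto_cpow_mul_factorial_div_Gamma (b : ℂ) :
    Tendsto (fun n : ℕ => (n : ℂ) ^ (b - 1) * (n.factorial : ℂ) * (Complex.Gamma (b + n))⁻¹)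
      atTop (𝓝 1) := by
  have key : ∀ m : ℕ, ∀ b : ℂ, 1 < b.re + m →
      Tendsto (fun n : ℕ => (n : ℂ) ^ (b - 1) * (n.factorial : ℂ) * (Complex.Gamma (b + n))⁻¹)
        atTop (𝓝 1) := by
    intro m
    induction m with
    | zero =>
      intro b hb
      have hre : 0 < (b - 1).re := by simpa using hb
      have hG := Complex.Gamma_ne_zero_of_re_pos hre
      have hs : ∀ m : ℕ, b - 1 ≠ -m := by
        intro m hm
        rw [hm] at hre
        simp at hre
        linarith [(Nat.cast_nonneg m : (0 : ℝ) ≤ m)]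
      -- The product in Euler's sequence for Γ(b - 1) equals Γ(b + n) / Γ(b - 1), so dividing
      -- Euler's limit by Γ(b - 1) gives the claim.
      have h := (Complex.GammaSeq_tendsto_Gamma (b - 1)).div_const (Complex.Gamma (b - 1))
      rw [div_self hG] at h
      refine h.congr fun n => ?_
      have h1 : b + (n : ℂ) = (b - 1) + ((n + 1 : ℕ) : ℂ) := by push_cast; ring
      rw [h1, Gamma_add_natCast_succ _ hs, Complex.GammaSeq, mul_inv, div_eq_mul_inv,
        div_eq_mul_inv]
      ring
    | succ m ih =>
      intro b hb
      have h := (ih (b + 1) (by simp; push_cast at hb; linarith)).mul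
        (tendsto_add_natCast_div_natCast b)
      rw [one_mul] at h
      refine h.congr' ?_
      filter_upwards [eventually_ne_atTop 0] with n hn
      have hn' : (n : ℂ) ≠ 0 := Nat.cast_ne_zero.mpr hn
      rw [Complex.one_div_Gamma_eq_self_mul_one_div_Gamma_add_one (b + n),
        show b + 1 - 1 = (b - 1) + 1 by ring, Complex.cpow_add _ _ hn', Complex.cpow_one,
        show b + 1 + (n : ℂ) = b + n + 1 by ring]
      field_simp
  obtain ⟨m, hm⟩ := exists_nat_gt (1 - b.re)
  exact key m b (by linarith)

lemma eventually_Gamma_add_natCast_ne_zero (b : ℂ) :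
    ∀ᶠ n : ℕ in atTop, Complex.Gamma (b + n) ≠ 0 := by
  obtain ⟨m, hm⟩ := exists_nat_gt (-b.re)
  filter_upwards [eventually_ge_atTop m] with n hn
  apply Complex.Gamma_ne_zero_of_re_pos
  have : (m : ℝ) ≤ n := by exact_mod_cast hn
  simp
  linarith

/-- `Γ(b + n) / (n ^ (b - 1) n!) → 1` for every complex `b`. -/
lemma tendsto_Gamma_div_cpow_mul_factorial (b : ℂ) :
    Tendsto (fun n : ℕ => Complex.Gamma (b + n) * ((n : ℂ) ^ (b - 1) * (n.factorial : ℂ))⁻¹)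
      atTop (𝓝 1) := by
  have h := (tendsto_cpow_mul_factorial_div_Gamma b).inv₀ one_ne_zero
  rw [inv_one] at h
  refine h.congr fun n => ?_
  rw [mul_inv, inv_inv, mul_comm]

lemma isBigO_inv_Gamma_add (b : ℂ) :
    (fun n : ℕ => (Complex.Gamma (b + n))⁻¹) =O[atTop]
      fun n : ℕ => (n : ℝ) ^ (1 - b.re) * ((n.factorial : ℝ))⁻¹ := by
  have h := (tendsto_cpow_mul_factorial_div_Gamma b).norm
  rw [norm_one] at h
  refine IsBigO.of_bound 2 ?_
  filter_upwards [eventually_gt_atTop 0, h.eventually (gt_mem_nhds one_lt_two)] with n hn h2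
  have hn' : (0 : ℝ) < n := Nat.cast_pos.mpr hn
  have hf : (0 : ℝ) < n.factorial := Nat.cast_pos.mpr n.factorial_pos
  rw [norm_mul, norm_mul, Complex.norm_natCast_cpow_of_pos hn, Complex.norm_natCast] at h2
  have hp : (0 : ℝ) < (n : ℝ) ^ (b.re - 1) := Real.rpow_pos_of_pos hn' _
  rw [Real.norm_of_nonneg (by positivity), show 1 - b.re = -(b.re - 1) by ring,
    Real.rpow_neg hn'.le, ← mul_inv, ← div_eq_mul_inv, le_div_iff₀ (by positivity), mul_comm]
  simpa using h2.le

lemma isBigO_Gamma_add (b : ℂ) :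
    (fun n : ℕ => Complex.Gamma (b + n)) =O[atTop]
      fun n : ℕ => (n : ℝ) ^ (b.re - 1) * (n.factorial : ℝ) := by
  have h := (tendsto_Gamma_div_cpow_mul_factorial b).norm
  rw [norm_one] at h
  refine IsBigO.of_bound 2 ?_
  filter_upwards [eventually_gt_atTop 0, h.eventually (gt_mem_nhds one_lt_two)] with n hn h2
  have hn' : (0 : ℝ) < n := Nat.cast_pos.mpr hn
  have hf : (0 : ℝ) < n.factorial := Nat.cast_pos.mpr n.factorial_pos
  rw [norm_mul, norm_inv, norm_mul, Complex.norm_natCast_cpow_of_pos hn,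
    Complex.norm_natCast] at h2
  have hp : (0 : ℝ) < (n : ℝ) ^ (b.re - 1) := Real.rpow_pos_of_pos hn' _
  rw [Real.norm_of_nonneg (by positivity)]
  rw [← div_eq_mul_inv, div_lt_iff₀ (by positivity)] at h2
  simpa using h2.le

/-- The reflection formula for `1 / Γ(a - n)`, valid for all large `n`. -/
lemma eventually_norm_inv_Gamma_sub (a : ℂ) :
    ∀ᶠ n : ℕ in atTop, ‖(Complex.Gamma (a - n))⁻¹‖ =
      ‖Complex.sin (Real.pi * a)‖ / Real.pi * ‖Complex.Gamma (1 - a + n)‖ := by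
  filter_upwards [eventually_Gamma_add_natCast_ne_zero (1 - a)] with n hn
  have h := Complex.Gamma_mul_Gamma_one_sub (a - n)
  have hs : ‖Complex.sin (Real.pi * (a - n))‖ = ‖Complex.sin (Real.pi * a)‖ := by
    have hc : Complex.cos (n * Real.pi) = (-1) ^ n := by
      exact_mod_cast congrArg ((↑) : ℝ → ℂ) (Real.cos_nat_mul_pi n)
    rw [mul_sub, mul_comm (Real.pi : ℂ) n, Complex.sin_sub, Complex.sin_nat_mul_pi, hc]
    simp
  rw [show 1 - (a - n) = 1 - a + n by ring] at h
  -- For integer a this stays true, both sides being 0: `Complex.Gamma` vanishes at the poles and π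
  -- / 0 = 0.
  have h2 : ‖Complex.Gamma (a - n)‖ * ‖Complex.Gamma (1 - a + n)‖ =
      Real.pi / ‖Complex.sin (Real.pi * a)‖ := by
    rw [← norm_mul, h, norm_div, hs, Complex.norm_real, Real.norm_of_nonneg Real.pi_pos.le]
  rw [norm_inv, inv_eq_iff_eq_inv, mul_inv, inv_div, ← h2, mul_assoc,
    mul_inv_cancel₀ (norm_ne_zero_iff.mpr hn), mul_one]

lemma isBigO_inv_Gamma_sub (a : ℂ) :
    (fun n : ℕ => (Complex.Gamma (a - n))⁻¹) =O[atTop]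
      fun n : ℕ => (n : ℝ) ^ (-a.re) * (n.factorial : ℝ) := by
  have h := (isBigO_Gamma_add (1 - a)).const_mul_left
    ((‖Complex.sin (Real.pi * a)‖ / Real.pi : ℝ) : ℂ)
  have h2 : (1 - a).re - 1 = -a.re := by simp
  rw [h2] at h
  refine (IsBigO.of_norm_left ?_)
  refine h.norm_left.congr' ?_ EventuallyEq.rfl
  filter_upwards [eventually_norm_inv_Gamma_sub a] with n hn
  rw [hn, norm_mul, Complex.norm_real, Real.norm_of_nonneg (by positivity)]

/-- The reflection formula makes 1 / Γ(a - n) grow like n!, which cancels the decay of 1 / Γ(b + n)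
and leaves a power of n. -/
lemma isBigO_inv_Gamma_pair (a b : ℂ) :
    (fun n : ℕ => (Complex.Gamma (a - n))⁻¹ * (Complex.Gamma (b + n))⁻¹) =O[atTop]
      fun n : ℕ => (n : ℝ) ^ (1 - a.re - b.re) := by
  refine ((isBigO_inv_Gamma_sub a).mul (isBigO_inv_Gamma_add b)).congr' EventuallyEq.rfl ?_
  filter_upwards [eventually_gt_atTop 0] with n hn
  have hn' : (0 : ℝ) < n := Nat.cast_pos.mpr hn
  have hf : (0 : ℝ) < n.factorial := Nat.cast_pos.mpr n.factorial_pos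
  rw [show 1 - a.re - b.re = -a.re + (1 - b.re) by ring, Real.rpow_add hn']
  field_simp

/-! ### The bilateral hypergeometric kernel -/

/-- The function `x ↦ 1 / (Γ(a + x) Γ(a' + x) Γ(b - x) Γ(b' - x))` on the integers. -/
noncomputable def kern (a a' b b' : ℂ) (x : ℤ) : ℂ :=
  (Complex.Gamma (a + x))⁻¹ * (Complex.Gamma (a' + x))⁻¹ *
    ((Complex.Gamma (b - x))⁻¹ * (Complex.Gamma (b' - x))⁻¹)

lemma kern_neg (a a' b b' : ℂ) (x : ℤ) : kern a a' b b' (-x) = kern b b' a a' x := by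
  unfold kern
  push_cast
  rw [sub_neg_eq_add, sub_neg_eq_add, ← sub_eq_add_neg, ← sub_eq_add_neg]
  ring

lemma kern_swap_left (a a' b b' : ℂ) : kern a a' b b' = kern a' a b b' := by
  funext x; unfold kern; ring

lemma kern_swap_right (a a' b b' : ℂ) : kern a a' b b' = kern a a' b' b := by
  funext x; unfold kern; ring

lemma isBigO_kern (a a' b b' : ℂ) :
    (fun n : ℕ => kern a a' b b' n) =O[atTop]
      fun n : ℕ => (n : ℝ) ^ (2 - (a + a' + b + b').re) := by
  refine ((isBigO_inv_Gamma_pair b a).mul (isBigO_inv_Gamma_pair b' a')).congr' ?_ ?_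
  · refine Eventually.of_forall fun n => ?_
    simp only [kern, Int.cast_natCast]
    ring
  · filter_upwards [eventually_gt_atTop 0] with n hn
    rw [← Real.rpow_add (Nat.cast_pos.mpr hn)]
    congr 1
    simp
    ring

lemma isBigO_kern_mul_pow (a a' b b' : ℂ) (k : ℕ) :
    (fun n : ℕ => kern a a' b b' n * ((n : ℤ) : ℂ) ^ k) =O[atTop]
      fun n : ℕ => (n : ℝ) ^ (2 - (a + a' + b + b').re + k) := by
  have h : (fun n : ℕ => ((n : ℤ) : ℂ) ^ k) =O[atTop] fun n : ℕ => (n : ℝ) ^ k :=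
    IsBigO.of_bound 1 (Eventually.of_forall fun n => by simp)
  refine ((isBigO_kern a a' b b').mul h).congr' EventuallyEq.rfl ?_
  filter_upwards [eventually_gt_atTop 0] with n hn
  rw [Real.rpow_add (Nat.cast_pos.mpr hn), Real.rpow_natCast]

lemma kern_neg_mul_pow (a a' b b' : ℂ) (k : ℕ) (x : ℤ) :
    kern a a' b b' (-x) * ((-x : ℤ) : ℂ) ^ k = (-1) ^ k * (kern b b' a a' x * (x : ℂ) ^ k) := by
  rw [kern_neg, Int.cast_neg, neg_pow]
  ring

lemma summable_kern_mul_pow {a a' b b' : ℂ} {k : ℕ} (h : k + 3 < (a + a' + b + b').re) :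
    Summable fun x : ℤ => kern a a' b b' x * (x : ℂ) ^ k := by
  have key : ∀ {a a' b b' : ℂ}, k + 3 < (a + a' + b + b').re →
      Summable fun n : ℕ => kern a a' b b' n * ((n : ℤ) : ℂ) ^ k := by
    intro a a' b b' h
    exact summable_of_isBigO_nat (Real.summable_nat_rpow.mpr (by linarith))
      (isBigO_kern_mul_pow a a' b b' k)
  refine Summable.of_nat_of_neg (key h) ?_
  simp only [kern_neg_mul_pow]
  refine (key ?_).mul_left _
  convert h using 2
  ring

lemma summable_kern {a a' b b' : ℂ} (h : 3 < (a + a' + b + b').re) :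
    Summable (kern a a' b b') := by
  simpa using summable_kern_mul_pow (k := 0) (by simpa using h)

lemma tendsto_kern_mul_pow_natCast {a a' b b' : ℂ} {k : ℕ} (h : k + 2 < (a + a' + b + b').re) :
    Tendsto (fun n : ℕ => kern a a' b b' n * ((n : ℤ) : ℂ) ^ k) atTop (𝓝 0) := by
  refine (isBigO_kern_mul_pow a a' b b' k).trans_tendsto ?_
  have := (tendsto_rpow_neg_atTop (y := (a + a' + b + b').re - 2 - k) (by linarith)).comp
    tendsto_natCast_atTop_atTop
  refine this.congr fun n => ?_
  simp only [Function.comp]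
  congr 1
  ring

lemma tendsto_atTop_of_tendsto_natCast {f : ℤ → ℂ} {l : Filter ℂ}
    (h : Tendsto (fun n : ℕ => f n) atTop l) : Tendsto f atTop l := by
  rw [← Nat.map_cast_int_atTop]
  exact h

lemma tendsto_kern_mul_pow_atTop {a a' b b' : ℂ} {k : ℕ} (h : k + 2 < (a + a' + b + b').re) :
    Tendsto (fun x : ℤ => kern a a' b b' x * (x : ℂ) ^ k) atTop (𝓝 0) :=
  tendsto_atTop_of_tendsto_natCast (tendsto_kern_mul_pow_natCast h)

lemma tendsto_kern_mul_pow_atBot {a a' b b' : ℂ} {k : ℕ} (h : k + 2 < (a + a' + b + b').re) :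
    Tendsto (fun x : ℤ => kern a a' b b' x * (x : ℂ) ^ k) atBot (𝓝 0) := by
  have h' : k + 2 < (b + b' + a + a').re := by
    convert h using 2
    ring
  have := ((tendsto_kern_mul_pow_atTop h').const_mul ((-1) ^ k)).comp tendsto_neg_atBot_atTop
  rw [mul_zero] at this
  refine this.congr fun x => ?_
  simp only [Function.comp]
  rw [← kern_neg_mul_pow, neg_neg]

/-! ### Telescoping sums over the integers -/

lemma hasSum_indicator_Iic_sub {g : ℤ → ℂ} (hs : Summable fun x => g x - g (x - 1))
    (hg : Tendsto g atBot (𝓝 0)) (y : ℤ) :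
    HasSum ((Set.Iic y).indicator fun x => g x - g (x - 1)) (g y) := by
  have hinj : Function.Injective fun n : ℕ => y - (n : ℤ) := fun m n h => by
    simpa using h
  rw [← hinj.hasSum_iff]
  · rw [((hs.indicator _).comp_injective hinj).hasSum_iff_tendsto_nat]
    have h1 : Tendsto (fun n : ℕ => g y - g (y - n)) atTop (𝓝 (g y - 0)) := by
      refine tendsto_const_nhds.sub (hg.comp ?_)
      exact tendsto_atBot_add_const_left _ y
        (tendsto_neg_atTop_atBot.comp tendsto_natCast_atTop_atTop)
    rw [sub_zero] at h1
    refine h1.congr fun n => ?_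
    have h2 := Finset.sum_range_sub' (fun n : ℕ => g (y - n)) n
    simp only [Nat.cast_zero, sub_zero] at h2
    rw [← h2]
    refine Finset.sum_congr rfl fun k _ => ?_
    rw [Function.comp, Set.indicator_of_mem (by simp)]
    push_cast
    rw [sub_sub]
  · intro x hx
    refine Set.indicator_of_notMem (fun hxy => hx ⟨(y - x).toNat, ?_⟩) _
    simp only [Set.mem_Iic] at hxy
    simp only
    omega

lemma hasSum_indicator_Ioi_sub {g : ℤ → ℂ} (hs : Summable fun x => g x - g (x - 1))
    (hg : Tendsto g atTop (𝓝 0)) (y : ℤ) :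
    HasSum ((Set.Ioi y).indicator fun x => g x - g (x - 1)) (-g y) := by
  have hinj : Function.Injective fun n : ℕ => y + 1 + (n : ℤ) := fun m n h => by
    simpa using h
  rw [← hinj.hasSum_iff]
  · rw [((hs.indicator _).comp_injective hinj).hasSum_iff_tendsto_nat]
    have h1 : Tendsto (fun n : ℕ => g (y + n) - g y) atTop (𝓝 (0 - g y)) := by
      refine (hg.comp ?_).sub tendsto_const_nhds
      exact tendsto_atTop_add_const_left _ y tendsto_natCast_atTop_atTop
    rw [zero_sub] at h1
    refine h1.congr fun n => ?_
    have h2 := Finset.sum_range_sub (fun n : ℕ => g (y + n)) n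
    simp only [Nat.cast_zero, add_zero] at h2
    rw [← h2]
    refine Finset.sum_congr rfl fun k _ => ?_
    rw [Function.comp, Set.indicator_of_mem (by simp; omega)]
    congr 2 <;> push_cast <;> ring
  · intro x hx
    refine Set.indicator_of_notMem (fun hxy => hx ⟨(x - y - 1).toNat, ?_⟩) _
    simp only [Set.mem_Ioi] at hxy
    simp only
    omega

lemma hasSum_sub_eq_zero {g : ℤ → ℂ} (hs : Summable fun x => g x - g (x - 1))
    (hbot : Tendsto g atBot (𝓝 0)) (htop : Tendsto g atTop (𝓝 0)) :
    HasSum (fun x => g x - g (x - 1)) 0 := by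
  have h := (hasSum_indicator_Iic_sub hs hbot 0).add (hasSum_indicator_Ioi_sub hs htop 0)
  rw [add_neg_cancel] at h
  convert h using 2 with x
  rcases le_or_gt x 0 with hx | hx
  · simp [hx, not_lt.mpr hx]
  · simp [hx, not_le.mpr hx]

/-! ### Dougall's bilateral summation formula -/

lemma kern_eq_add_mul_kern (a a' b b' : ℂ) (x : ℤ) :
    kern a a' b b' x = (a + x) * kern (a + 1) a' b b' x := by
  unfold kern
  rw [Complex.one_div_Gamma_eq_self_mul_one_div_Gamma_add_one (a + x),
    show a + x + 1 = a + 1 + (x : ℂ) by ring]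
  ring

/-- With `kern_sub_one_sub_one`: the lowered kernel at x and at x - 1 is a quadratic multiple of the
same `kern a a' b b' x`. All telescoping identities below rest on this. -/
lemma kern_sub_one (a a' b b' : ℂ) (x : ℤ) :
    kern a a' (b - 1) (b' - 1) x = (b - 1 - x) * (b' - 1 - x) * kern a a' b b' x := by
  unfold kern
  rw [Complex.one_div_Gamma_eq_self_mul_one_div_Gamma_add_one (b - 1 - x),
    Complex.one_div_Gamma_eq_self_mul_one_div_Gamma_add_one (b' - 1 - x),
    show b - 1 - x + 1 = b - (x : ℂ) by ring, show b' - 1 - x + 1 = b' - (x : ℂ) by ring]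
  ring

lemma kern_sub_one_sub_one (a a' b b' : ℂ) (x : ℤ) :
    kern a a' (b - 1) (b' - 1) (x - 1) = (a - 1 + x) * (a' - 1 + x) * kern a a' b b' x := by
  unfold kern
  push_cast
  rw [Complex.one_div_Gamma_eq_self_mul_one_div_Gamma_add_one (a + (x - 1)),
    Complex.one_div_Gamma_eq_self_mul_one_div_Gamma_add_one (a' + (x - 1)),
    show a + (x - 1) + 1 = a + (x : ℂ) by ring, show a' + (x - 1) + 1 = a' + (x : ℂ) by ring,
    show b - 1 - (x - 1) = b - (x : ℂ) by ring, show b' - 1 - (x - 1) = b' - (x : ℂ) by ring]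
  ring

/-- The sum of the bilateral kernel. -/
noncomputable def bilateralSum (a a' b b' : ℂ) : ℂ := ∑' x : ℤ, kern a a' b b' x

/-- The right-hand side of Dougall's formula. -/
noncomputable def dougallValue (a a' b b' : ℂ) : ℂ :=
  Complex.Gamma (a + a' + b + b' - 3) *
    ((Complex.Gamma (a + b - 1))⁻¹ * (Complex.Gamma (a + b' - 1))⁻¹ *
      ((Complex.Gamma (a' + b - 1))⁻¹ * (Complex.Gamma (a' + b' - 1))⁻¹))

lemma bilateralSum_swap_left (a a' b b' : ℂ) :
    bilateralSum a a' b b' = bilateralSum a' a b b' := by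
  rw [bilateralSum, kern_swap_left]; rfl

lemma bilateralSum_swap_right (a a' b b' : ℂ) :
    bilateralSum a a' b b' = bilateralSum a a' b' b := by
  rw [bilateralSum, kern_swap_right]; rfl

lemma bilateralSum_comm (a a' b b' : ℂ) : bilateralSum a a' b b' = bilateralSum b b' a a' := by
  rw [bilateralSum, ← (Equiv.neg ℤ).tsum_eq]
  simp only [Equiv.neg_apply, kern_neg]
  rfl

lemma dougallValue_swap_left (a a' b b' : ℂ) :
    dougallValue a a' b b' = dougallValue a' a b b' := by
  unfold dougallValue
  rw [add_comm a a']
  ring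

lemma dougallValue_swap_right (a a' b b' : ℂ) :
    dougallValue a a' b b' = dougallValue a a' b' b := by
  unfold dougallValue
  rw [show a + a' + b + b' = a + a' + b' + b by ring]
  ring

lemma dougallValue_comm (a a' b b' : ℂ) : dougallValue a a' b b' = dougallValue b b' a a' := by
  unfold dougallValue
  rw [show a + a' + b + b' = b + b' + a + a' by ring, add_comm a b, add_comm a b', add_comm a' b,
    add_comm a' b']
  ring

/-- The difference of the two summands is the increment of `kern (a + 1) a' (b - 1) (b' - 1)`, which
tends to 0 at both ends. -/
lemma bilateralSum_shift {a a' b b' : ℂ} (h : 3 < (a + a' + b + b').re) :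
    (a + a' + b + b' - 3) * bilateralSum a a' b b' =
      (a + b - 1) * (a + b' - 1) * bilateralSum (a + 1) a' b b' := by
  have h1 : 4 < (a + 1 + a' + b + b').re := by
    simp only [Complex.add_re, Complex.one_re] at h ⊢
    linarith
  have hs0 := summable_kern h
  have hs1 := summable_kern (a := a + 1) (a' := a') (b := b) (b' := b') (by linarith)
  have hg : ∀ x : ℤ, kern (a + 1) a' (b - 1) (b' - 1) x - kern (a + 1) a' (b - 1) (b' - 1) (x - 1) =
      (a + b - 1) * (a + b' - 1) * kern (a + 1) a' b b' x -
        (a + a' + b + b' - 3) * kern a a' b b' x := by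
    intro x
    rw [kern_sub_one, kern_sub_one_sub_one, kern_eq_add_mul_kern a]
    ring
  have hsum := (hs1.hasSum.mul_left ((a + b - 1) * (a + b' - 1))).sub
    (hs0.hasSum.mul_left (a + a' + b + b' - 3))
  simp only [← hg] at hsum
  have hre : ((0 : ℕ) : ℝ) + 2 < (a + 1 + a' + (b - 1) + (b' - 1)).re := by
    simp only [Complex.add_re, Complex.sub_re, Complex.one_re] at h ⊢
    push_cast
    linarith
  have hz := hasSum_sub_eq_zero hsum.summable
    (by simpa using tendsto_kern_mul_pow_atBot hre) (by simpa using tendsto_kern_mul_pow_atTop hre)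
  exact (sub_eq_zero.mp (hsum.unique hz)).symm

lemma dougallValue_shift {a a' b b' : ℂ} (h : 3 < (a + a' + b + b').re) :
    (a + a' + b + b' - 3) * dougallValue a a' b b' =
      (a + b - 1) * (a + b' - 1) * dougallValue (a + 1) a' b b' := by
  unfold dougallValue
  have h0 : a + a' + b + b' - 3 ≠ 0 := by
    intro h0
    have := congrArg Complex.re h0
    simp at this h
    linarith
  rw [Complex.one_div_Gamma_eq_self_mul_one_div_Gamma_add_one (a + b - 1),
    Complex.one_div_Gamma_eq_self_mul_one_div_Gamma_add_one (a + b' - 1),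
    show a + 1 + a' + b + b' - 3 = a + a' + b + b' - 3 + 1 by ring, Complex.Gamma_add_one _ h0,
    show a + b - 1 + 1 = a + 1 + b - 1 by ring, show a + b' - 1 + 1 = a + 1 + b' - 1 by ring]
  ring

lemma dougall_of_shift {a a' b b' : ℂ} (h : 3 < (a + a' + b + b').re)
    (h1 : bilateralSum (a + 1) a' b b' = dougallValue (a + 1) a' b b') :
    bilateralSum a a' b b' = dougallValue a a' b b' := by
  have h0 : a + a' + b + b' - 3 ≠ 0 := by
    intro h0
    have := congrArg Complex.re h0
    simp at this h
    linarith
  apply mul_left_cancel₀ h0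
  rw [bilateralSum_shift h, dougallValue_shift h, h1]

/-- The symmetries carry the shift in `a` to the other three parameters. -/
lemma dougall_of_shift_all {a a' b b' : ℂ} (h : 3 < (a + a' + b + b').re)
    (h1 : bilateralSum (a + 1) (a' + 1) (b + 1) (b' + 1) =
      dougallValue (a + 1) (a' + 1) (b + 1) (b' + 1)) :
    bilateralSum a a' b b' = dougallValue a a' b b' := by
  simp only [Complex.add_re] at h
  apply dougall_of_shift (by simpa using h)
  rw [bilateralSum_swap_left, dougallValue_swap_left]
  apply dougall_of_shift (by simp; linarith)
  rw [bilateralSum_comm, dougallValue_comm]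
  apply dougall_of_shift (by simp; linarith)
  rw [bilateralSum_swap_left, dougallValue_swap_left]
  apply dougall_of_shift (by simp; linarith)
  rw [bilateralSum_comm, dougallValue_comm, bilateralSum_swap_left, dougallValue_swap_left,
    bilateralSum_swap_right, dougallValue_swap_right, h1]

/-- The ratio of the two sides of Dougall's formula. -/
noncomputable def dougallRatio (a a' b b' : ℂ) : ℂ :=
  bilateralSum a a' b b' / dougallValue a a' b b'

lemma dougallRatio_swap_left (a a' b b' : ℂ) :
    dougallRatio a a' b b' = dougallRatio a' a b b' := by
  rw [dougallRatio, bilateralSum_swap_left, dougallValue_swap_left]; rfl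

lemma dougallRatio_swap_right (a a' b b' : ℂ) :
    dougallRatio a a' b b' = dougallRatio a a' b' b := by
  rw [dougallRatio, bilateralSum_swap_right, dougallValue_swap_right]; rfl

lemma dougallRatio_comm (a a' b b' : ℂ) : dougallRatio a a' b b' = dougallRatio b b' a a' := by
  rw [dougallRatio, bilateralSum_comm, dougallValue_comm]; rfl

lemma dougallRatio_shift_left {a a' b b' : ℂ} (ha : 1 ≤ a.re) (ha' : 1 ≤ a'.re) (hb : 1 ≤ b.re)
    (hb' : 1 ≤ b'.re) : dougallRatio (a + 1) a' b b' = dougallRatio a a' b b' := by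
  have h : 3 < (a + a' + b + b').re := by simp; linarith
  have h0 : a + a' + b + b' - 3 ≠ 0 := by
    intro h0
    have := congrArg Complex.re h0
    simp at this
    linarith
  have h1 : a + b - 1 ≠ 0 := by
    intro h0
    have := congrArg Complex.re h0
    simp at this
    linarith
  have h2 : a + b' - 1 ≠ 0 := by
    intro h0
    have := congrArg Complex.re h0
    simp at this
    linarith
  unfold dougallRatio
  rw [← mul_div_mul_left (bilateralSum a a' b b') _ h0, bilateralSum_shift h, dougallValue_shift h,
    mul_div_mul_left _ _ (mul_ne_zero h1 h2)]

lemma dougallRatio_shift_right {a a' b b' : ℂ} (ha : 1 ≤ a.re) (ha' : 1 ≤ a'.re) (hb : 1 ≤ b.re)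
    (hb' : 1 ≤ b'.re) : dougallRatio a a' (b + 1) b' = dougallRatio a a' b b' := by
  rw [dougallRatio_comm, dougallRatio_shift_left hb hb' ha ha', dougallRatio_comm]

lemma dougallRatio_add_natCast {a a' b b' : ℂ} (ha : 1 ≤ a.re) (ha' : 1 ≤ a'.re) (hb : 1 ≤ b.re)
    (hb' : 1 ≤ b'.re) (k : ℕ) : dougallRatio (a + k) a' (b + k) b' = dougallRatio a a' b b' := by
  induction k with
  | zero => simp
  | succ k ih =>
    have h1 : 1 ≤ (a + k).re := by simp; linarith [(Nat.cast_nonneg k : (0 : ℝ) ≤ k)]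
    have h2 : 1 ≤ (b + k).re := by simp; linarith [(Nat.cast_nonneg k : (0 : ℝ) ≤ k)]
    have h3 : 1 ≤ (b + k + 1).re := by rw [Complex.add_re, Complex.one_re]; linarith
    rw [Nat.cast_succ, ← add_assoc, ← add_assoc, dougallRatio_shift_left h1 ha' h3 hb',
      dougallRatio_shift_right h1 ha' h2 hb', ih]

/-- `Γ(a + k) Γ(b + k) / (Γ(c + k) Γ(d + k)) → 1` when `a + b = c + d`. -/
lemma tendsto_Gamma_ratio {a b c d : ℂ} (h : a + b = c + d) :
    Tendsto (fun k : ℕ => Complex.Gamma (a + k) * Complex.Gamma (b + k) *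
      ((Complex.Gamma (c + k))⁻¹ * (Complex.Gamma (d + k))⁻¹)) atTop (𝓝 1) := by
  have hl := ((tendsto_Gamma_div_cpow_mul_factorial a).mul
    (tendsto_Gamma_div_cpow_mul_factorial b)).mul
    ((tendsto_cpow_mul_factorial_div_Gamma c).mul (tendsto_cpow_mul_factorial_div_Gamma d))
  simp only [mul_one] at hl
  refine hl.congr' ?_
  filter_upwards [eventually_ne_atTop 0] with k hk
  have hk' : (k : ℂ) ≠ 0 := Nat.cast_ne_zero.mpr hk
  have hf : (k.factorial : ℂ) ≠ 0 := Nat.cast_ne_zero.mpr k.factorial_ne_zero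
  have hp : (k : ℂ) ^ (c - 1) * (k : ℂ) ^ (d - 1) = (k : ℂ) ^ (a - 1) * (k : ℂ) ^ (b - 1) := by
    rw [← Complex.cpow_add _ _ hk', ← Complex.cpow_add _ _ hk']
    congr 1
    linear_combination -h
  have ha0 : (k : ℂ) ^ (a - 1) ≠ 0 := by simp [Complex.cpow_eq_zero_iff, hk]
  have hb0 : (k : ℂ) ^ (b - 1) ≠ 0 := by simp [Complex.cpow_eq_zero_iff, hk]
  calc _ = Complex.Gamma (a + k) * Complex.Gamma (b + k) *
      ((Complex.Gamma (c + k))⁻¹ * (Complex.Gamma (d + k))⁻¹) *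
        (((k : ℂ) ^ (c - 1) * (k : ℂ) ^ (d - 1)) * ((k : ℂ) ^ (a - 1) * (k : ℂ) ^ (b - 1))⁻¹) *
        ((k.factorial : ℂ) * (k.factorial : ℂ)⁻¹) ^ 2 := by
        rw [mul_inv, mul_inv, mul_inv]; ring
    _ = _ := by
        rw [hp, mul_inv_cancel₀ (mul_ne_zero ha0 hb0), mul_inv_cancel₀ hf]; ring

/-- The arguments a + a' + b + b' - 3 and a + b - 1 move by 2k, and their Γ-quotient behaves like
(2k)^(a' + b' - 2). The powers of k cancel against the other factors; the power of 2 survives. -/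
lemma tendsto_dougallValue_mul_Gamma (a a' b b' : ℂ) :
    Tendsto (fun k : ℕ => dougallValue (a + k) a' (b + k) b' *
      (Complex.Gamma (a + k) * Complex.Gamma (b + k))) atTop
      (𝓝 ((2 : ℂ) ^ (a' + b' - 2) * (Complex.Gamma (a' + b' - 1))⁻¹)) := by
  have h2 : Tendsto (fun k : ℕ => 2 * k) atTop atTop :=
    tendsto_id.const_mul_atTop' (by norm_num)
  have hl := ((((tendsto_Gamma_div_cpow_mul_factorial (a + a' + b + b' - 3)).comp h2).mul
    ((tendsto_cpow_mul_factorial_div_Gamma (a + b - 1)).comp h2)).mul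
    ((tendsto_cpow_mul_factorial_div_Gamma (a + b' - 1)).mul
      (tendsto_cpow_mul_factorial_div_Gamma (a' + b - 1)))).mul
    ((tendsto_Gamma_div_cpow_mul_factorial a).mul (tendsto_Gamma_div_cpow_mul_factorial b))
  simp only [mul_one] at hl
  have hl := hl.mul_const ((2 : ℂ) ^ (a' + b' - 2) * (Complex.Gamma (a' + b' - 1))⁻¹)
  rw [one_mul] at hl
  refine hl.congr' ?_
  filter_upwards [eventually_ne_atTop 0] with k hk
  have hk' : (k : ℂ) ≠ 0 := Nat.cast_ne_zero.mpr hk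
  have hf : (k.factorial : ℂ) ≠ 0 := Nat.cast_ne_zero.mpr k.factorial_ne_zero
  have hf2 : ((2 * k).factorial : ℂ) ≠ 0 := Nat.cast_ne_zero.mpr (2 * k).factorial_ne_zero
  have h20 : (2 : ℂ) ≠ 0 := two_ne_zero
  have hcast : ∀ s : ℂ, ((2 * k : ℕ) : ℂ) ^ s = (2 : ℂ) ^ s * (k : ℂ) ^ s := by
    intro s
    rw [Nat.cast_mul]
    exact Complex.natCast_mul_natCast_cpow 2 k s
  have hp : (k : ℂ) ^ (a + b - 1 - 1) * (k : ℂ) ^ (a + b' - 1 - 1) * (k : ℂ) ^ (a' + b - 1 - 1) =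
      (k : ℂ) ^ (a + a' + b + b' - 3 - 1) * (k : ℂ) ^ (a - 1) * (k : ℂ) ^ (b - 1) := by
    simp only [← Complex.cpow_add _ _ hk']
    congr 1
    ring
  have hp2 : (2 : ℂ) ^ (a + b - 1 - 1) * (2 : ℂ) ^ (a' + b' - 2) =
      (2 : ℂ) ^ (a + a' + b + b' - 3 - 1) := by
    simp only [← Complex.cpow_add _ _ h20]
    congr 1
    ring
  have ha0 : (k : ℂ) ^ (a - 1) ≠ 0 := by simp [Complex.cpow_eq_zero_iff, hk]
  have hb0 : (k : ℂ) ^ (b - 1) ≠ 0 := by simp [Complex.cpow_eq_zero_iff, hk]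
  have hs0 : (k : ℂ) ^ (a + a' + b + b' - 3 - 1) ≠ 0 := by simp [Complex.cpow_eq_zero_iff, hk]
  have hs2 : (2 : ℂ) ^ (a + a' + b + b' - 3 - 1) ≠ 0 := by simp [Complex.cpow_eq_zero_iff]
  have e1 : a + k + a' + (b + k) + b' - 3 = a + a' + b + b' - 3 + ((2 * k : ℕ) : ℂ) := by
    push_cast; ring
  have e2 : a + k + (b + k) - 1 = a + b - 1 + ((2 * k : ℕ) : ℂ) := by push_cast; ring
  have e3 : a + k + b' - 1 = a + b' - 1 + (k : ℂ) := by ring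
  have e4 : a' + (b + k) - 1 = a' + b - 1 + (k : ℂ) := by ring
  simp only [Function.comp, hcast]
  unfold dougallValue
  rw [e1, e2, e3, e4]
  generalize Complex.Gamma (a + a' + b + b' - 3 + ((2 * k : ℕ) : ℂ)) = G1
  generalize (Complex.Gamma (a + b - 1 + ((2 * k : ℕ) : ℂ)))⁻¹ = G2
  generalize (Complex.Gamma (a + b' - 1 + (k : ℂ)))⁻¹ = G3
  generalize (Complex.Gamma (a' + b - 1 + (k : ℂ)))⁻¹ = G4
  generalize (Complex.Gamma (a' + b' - 1))⁻¹ = G5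
  generalize Complex.Gamma (a + k) = G6
  generalize Complex.Gamma (b + k) = G7
  calc _ = G1 * (G2 * G3 * (G4 * G5)) * (G6 * G7) *
        (((k : ℂ) ^ (a + b - 1 - 1) * (k : ℂ) ^ (a + b' - 1 - 1) * (k : ℂ) ^ (a' + b - 1 - 1)) *
          ((k : ℂ) ^ (a + a' + b + b' - 3 - 1) * (k : ℂ) ^ (a - 1) * (k : ℂ) ^ (b - 1))⁻¹) *
        (((2 : ℂ) ^ (a + b - 1 - 1) * (2 : ℂ) ^ (a' + b' - 2)) *
          ((2 : ℂ) ^ (a + a' + b + b' - 3 - 1))⁻¹) *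
        ((k.factorial : ℂ) * (k.factorial : ℂ)⁻¹) ^ 2 *
        (((2 * k).factorial : ℂ) * ((2 * k).factorial : ℂ)⁻¹) := by
        simp only [mul_inv]; ring
    _ = _ := by
        rw [hp, hp2, mul_inv_cancel₀ (mul_ne_zero (mul_ne_zero hs0 ha0) hb0),
          mul_inv_cancel₀ hs2, mul_inv_cancel₀ hf, mul_inv_cancel₀ hf2]
        ring

lemma norm_sub_le_norm_add (a b : ℂ) : ∀ᶠ j : ℕ in atTop, ∀ᶠ k : ℕ in atTop, ∀ n : ℕ, j ≤ n →
    ‖b + k - n - 1‖ ≤ ‖a + k + n‖ ∧ a + k + n ≠ 0 := by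
  obtain ⟨j0, hj0⟩ := exists_nat_gt (b.re - a.re)
  -- The squared real parts differ by (Re a - Re b + 1 + 2n)(Re a + Re b + 2k - 1). The first factor
  -- is at least 1 by the choice of `j0`, the second at least (Im b)² by that of `k0`; the bound 1 -
  -- Re a gives nonvanishing.
  obtain ⟨k0, hk0⟩ := exists_nat_gt (max (1 - a.re) (b.im ^ 2 - a.re - b.re + 1))
  filter_upwards [eventually_ge_atTop j0] with j hj
  filter_upwards [eventually_ge_atTop k0] with k hk n hn
  have hj' : (j0 : ℝ) ≤ n := by exact_mod_cast hj.trans hn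
  have hk' : (k0 : ℝ) ≤ k := by exact_mod_cast hk
  have hk1 := (le_max_left _ _).trans_lt hk0
  have hk2 := (le_max_right _ _).trans_lt hk0
  have hn0 : (0 : ℝ) ≤ n := Nat.cast_nonneg n
  have hkk : (0 : ℝ) ≤ k := Nat.cast_nonneg k
  refine ⟨?_, fun h => ?_⟩
  · rw [← sq_le_sq₀ (norm_nonneg _) (norm_nonneg _), ← Complex.normSq_eq_norm_sq,
      ← Complex.normSq_eq_norm_sq, Complex.normSq_apply, Complex.normSq_apply]
    simp only [Complex.add_re, Complex.sub_re, Complex.natCast_re, Complex.one_re, Complex.add_im,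
      Complex.sub_im, Complex.natCast_im, Complex.one_im, add_zero, sub_zero]
    have h1 : 1 ≤ a.re - b.re + 1 + 2 * n := by linarith
    have h2 : b.im ^ 2 ≤ a.re + b.re + 2 * k - 1 := by linarith
    nlinarith [mul_le_mul h1 h2 (sq_nonneg _) (by linarith), sq_nonneg a.im]
  · have := congrArg Complex.re h
    simp at this
    linarith

/-- The ratio `Γ(a + k) Γ(b + k) / (Γ(a + k + n) Γ(b + k - n))` is bounded for large `k`,
uniformly in `n`. -/
lemma eventually_norm_Gamma_ratio_le_nat (a b : ℂ) : ∀ᶠ k : ℕ in atTop, ∀ n : ℕ,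
    ‖Complex.Gamma (a + k) * Complex.Gamma (b + k) *
      ((Complex.Gamma (a + k + n))⁻¹ * (Complex.Gamma (b + k - n))⁻¹)‖ ≤ 2 := by
  obtain ⟨j, hj⟩ := (norm_sub_le_norm_add a b).exists
  have hfin : ∀ᶠ k : ℕ in atTop, ∀ n ∈ Finset.range (j + 1),
      ‖Complex.Gamma (a + k) * Complex.Gamma (b + k) *
        ((Complex.Gamma (a + k + n))⁻¹ * (Complex.Gamma (b + k - n))⁻¹)‖ ≤ 2 := by
    rw [Filter.eventually_all_finset]
    intro n _
    have h := (tendsto_Gamma_ratio (a := a) (b := b) (c := a + n) (d := b - n) (by ring)).norm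
    rw [norm_one] at h
    filter_upwards [h.eventually (gt_mem_nhds one_lt_two)] with k hk
    rw [add_right_comm, add_sub_right_comm]
    exact hk.le
  filter_upwards [hfin, hj] with k hk hjk n
  -- The finitely many n ≤ j are handled by the limit 1. Beyond j, each increment of n multiplies
  -- the ratio by (b + k - n - 1) / (a + k + n), of norm at most 1.
  rcases le_total n j with hn | hn
  · exact hk n (by simpa using Nat.lt_succ_of_le hn)
  · induction n, hn using Nat.le_induction with
    | base => exact hk j (by simp)
    | succ n hn ih =>
      obtain ⟨h1, h2⟩ := hjk n hn
      have h3 : (Complex.Gamma (a + k + n))⁻¹ =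
          (a + k + n) * (Complex.Gamma (a + k + (n + 1 : ℕ)))⁻¹ := by
        rw [Complex.one_div_Gamma_eq_self_mul_one_div_Gamma_add_one, Nat.cast_succ, ← add_assoc]
      have h4 : (Complex.Gamma (b + k - (n + 1 : ℕ)))⁻¹ =
          (b + k - n - 1) * (Complex.Gamma (b + k - n))⁻¹ := by
        rw [Complex.one_div_Gamma_eq_self_mul_one_div_Gamma_add_one]
        push_cast
        rw [show b + k - (n + 1) = b + k - n - (1 : ℂ) by ring, sub_add_cancel]
      have hpos : 0 < ‖a + k + (n : ℂ)‖ := norm_pos_iff.mpr h2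
      refine le_of_mul_le_mul_left ?_ hpos
      calc _ = ‖b + k - n - 1‖ * ‖Complex.Gamma (a + k) * Complex.Gamma (b + k) *
            ((Complex.Gamma (a + k + n))⁻¹ * (Complex.Gamma (b + k - n))⁻¹)‖ := by
            rw [h3, h4, ← norm_mul, ← norm_mul]
            congr 1
            ring
        _ ≤ ‖a + k + (n : ℂ)‖ * 2 := mul_le_mul h1 ih (norm_nonneg _) hpos.le

lemma eventually_norm_Gamma_ratio_le (a b : ℂ) : ∀ᶠ k : ℕ in atTop, ∀ x : ℤ,
    ‖Complex.Gamma (a + k) * Complex.Gamma (b + k) *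
      ((Complex.Gamma (a + k + x))⁻¹ * (Complex.Gamma (b + k - x))⁻¹)‖ ≤ 2 := by
  filter_upwards [eventually_norm_Gamma_ratio_le_nat a b,
    eventually_norm_Gamma_ratio_le_nat b a] with k h1 h2 x
  obtain ⟨n, rfl | rfl⟩ := x.eq_nat_or_neg
  · simpa using h1 n
  · have := h2 n
    rw [mul_comm (Complex.Gamma (b + k)), mul_comm (Complex.Gamma (b + k + n))⁻¹] at this
    simpa [sub_eq_add_neg] using this

lemma summable_inv_Gamma_pair {a b : ℂ} (h : 2 < (a + b).re) :
    Summable fun x : ℤ => (Complex.Gamma (a + x))⁻¹ * (Complex.Gamma (b - x))⁻¹ := by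
  have key : ∀ {a b : ℂ}, 2 < (a + b).re →
      Summable fun n : ℕ => (Complex.Gamma (a - n))⁻¹ * (Complex.Gamma (b + n))⁻¹ := by
    intro a b h
    simp at h
    exact summable_of_isBigO_nat (Real.summable_nat_rpow.mpr (by linarith))
      (isBigO_inv_Gamma_pair a b)
  refine Summable.of_nat_of_neg ?_ ?_
  · simpa [mul_comm] using key (a := b) (b := a) (by rwa [add_comm])
  · simpa [sub_eq_add_neg] using key h

lemma tendsto_bilateralSum_mul_Gamma (a b : ℂ) {a' b' : ℂ} (h : 2 < (a' + b').re) :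
    Tendsto (fun k : ℕ => bilateralSum (a + k) a' (b + k) b' *
      (Complex.Gamma (a + k) * Complex.Gamma (b + k))) atTop
      (𝓝 (∑' x : ℤ, (Complex.Gamma (a' + x))⁻¹ * (Complex.Gamma (b' - x))⁻¹)) := by
  have hs := summable_inv_Gamma_pair h
  simp only [bilateralSum, ← tsum_mul_right]
  refine tendsto_tsum_of_dominated_convergence
    (bound := fun x : ℤ => 2 * ‖(Complex.Gamma (a' + x))⁻¹ * (Complex.Gamma (b' - x))⁻¹‖)
    (hs.norm.mul_left 2) ?_ ?_
  · intro x
    have h := (tendsto_Gamma_ratio (a := a) (b := b) (c := a + x) (d := b - x) (by ring)).mul_const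
      ((Complex.Gamma (a' + x))⁻¹ * (Complex.Gamma (b' - x))⁻¹)
    rw [one_mul] at h
    refine h.congr fun k => ?_
    rw [kern, add_right_comm, ← add_sub_right_comm]
    ring
  · filter_upwards [eventually_norm_Gamma_ratio_le a b] with k hk x
    refine le_trans (le_of_eq ?_) (mul_le_mul_of_nonneg_right (hk x) (norm_nonneg _))
    rw [← norm_mul, kern]
    congr 1
    ring

/-- The ratio is constant along simultaneous shifts of a and b, hence equals its limit. The point is
that the right-hand side is free of a and b. -/
lemma dougallRatio_eq_of_one_lt_re {a a' b b' : ℂ} (ha : 1 ≤ a.re) (ha' : 1 < a'.re)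
    (hb : 1 ≤ b.re) (hb' : 1 < b'.re) :
    dougallRatio a a' b b' = (∑' x : ℤ, (Complex.Gamma (a' + x))⁻¹ * (Complex.Gamma (b' - x))⁻¹) /
      ((2 : ℂ) ^ (a' + b' - 2) * (Complex.Gamma (a' + b' - 1))⁻¹) := by
  have hG : Complex.Gamma (a' + b' - 1) ≠ 0 :=
    Complex.Gamma_ne_zero_of_re_pos (by simp; linarith)
  have h2 : (2 : ℂ) ^ (a' + b' - 2) ≠ 0 := by simp [Complex.cpow_eq_zero_iff]
  have hl := (tendsto_bilateralSum_mul_Gamma a b (a' := a') (b' := b') (by simp; linarith)).div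
    (tendsto_dougallValue_mul_Gamma a a' b b') (mul_ne_zero h2 (inv_ne_zero hG))
  refine tendsto_nhds_unique (tendsto_const_nhds.congr' ?_) hl
  filter_upwards [eventually_Gamma_add_natCast_ne_zero a,
    eventually_Gamma_add_natCast_ne_zero b] with k h1 h2
  rw [← dougallRatio_add_natCast ha ha'.le hb hb'.le k, Pi.div_apply,
    mul_div_mul_right _ _ (mul_ne_zero h1 h2)]
  rfl

lemma kern_one_eq_ite (x : ℤ) : kern 1 1 1 1 x = if x = 0 then 1 else 0 := by
  split_ifs with h
  · simp [h, kern]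
  · rcases lt_or_gt_of_ne h with hx | hx
    · have : Complex.Gamma (1 + x) = 0 := by
        rw [Complex.Gamma_eq_zero_iff]
        refine ⟨(-x - 1).toNat, ?_⟩
        have : (((-x - 1).toNat : ℤ) : ℂ) = ((-x - 1 : ℤ) : ℂ) := by
          rw [Int.toNat_of_nonneg (by omega)]
        rw [Int.cast_natCast] at this
        rw [this]
        push_cast
        ring
      simp [kern, this]
    · have : Complex.Gamma (1 - x) = 0 := by
        rw [Complex.Gamma_eq_zero_iff]
        refine ⟨(x - 1).toNat, ?_⟩
        have : (((x - 1).toNat : ℤ) : ℂ) = ((x - 1 : ℤ) : ℂ) := by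
          rw [Int.toNat_of_nonneg (by omega)]
        rw [Int.cast_natCast] at this
        rw [this]
        push_cast
        ring
      simp [kern, this]

lemma dougallRatio_one : dougallRatio 1 1 1 1 = 1 := by
  have h : bilateralSum 1 1 1 1 = 1 := by
    rw [bilateralSum, tsum_eq_single 0 (fun x hx => by rw [kern_one_eq_ite, if_neg hx]),
      kern_one_eq_ite, if_pos rfl]
  have h2 : dougallValue 1 1 1 1 = 1 := by
    rw [dougallValue, show (1 : ℂ) + 1 + 1 + 1 - 3 = 1 by norm_num,
      show (1 : ℂ) + 1 - 1 = 1 by norm_num]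
    simp
  rw [dougallRatio, h, h2, div_one]

/-- The limit argument needs real parts strictly above 1, so the explicit value at 1 is moved to 2
by shifts. -/
lemma dougallRatio_two : dougallRatio 2 2 2 2 = 1 := by
  have e : (2 : ℂ) = 1 + (1 : ℕ) := by norm_num
  have h1 := dougallRatio_add_natCast (a := 1) (a' := 1) (b := 1) (b' := 1)
    (by simp) (by simp) (by simp) (by simp) 1
  have h2 := dougallRatio_add_natCast (a := 1) (a' := 2) (b := 1) (b' := 2)
    (by simp) (by simp) (by simp) (by simp) 1
  rw [← e] at h1 h2
  rw [h2, dougallRatio_swap_left, dougallRatio_swap_right, h1, dougallRatio_one]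

lemma dougallRatio_eq_one {a a' b b' : ℂ} (ha : 1 < a.re) (ha' : 1 < a'.re) (hb : 1 < b.re)
    (hb' : 1 < b'.re) : dougallRatio a a' b b' = 1 := by
  rw [dougallRatio_eq_of_one_lt_re ha.le ha' hb.le hb',
    ← dougallRatio_eq_of_one_lt_re (a := 2) (b := 2) (by simp) ha' (by simp) hb',
    dougallRatio_swap_left, dougallRatio_swap_right,
    dougallRatio_eq_of_one_lt_re ha'.le (by simp) hb'.le (by simp),
    ← dougallRatio_eq_of_one_lt_re (a := 2) (b := 2) (by simp) (by simp) (by simp) (by simp),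
    dougallRatio_two]

lemma bilateralSum_eq_dougallValue {a a' b b' : ℂ} (h : 3 < (a + a' + b + b').re) :
    bilateralSum a a' b b' = dougallValue a a' b b' := by
  have key : ∀ m : ℕ, ∀ a a' b b' : ℂ, 3 < (a + a' + b + b').re → 1 < a.re + m → 1 < a'.re + m →
      1 < b.re + m → 1 < b'.re + m → bilateralSum a a' b b' = dougallValue a a' b b' := by
    intro m
    induction m with
    | zero =>
      intro a a' b b' _ ha ha' hb hb'
      simp only [Nat.cast_zero, add_zero] at ha ha' hb hb'
      have h1 := dougallRatio_eq_one ha ha' hb hb'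
      exact eq_of_div_eq_one h1
    | succ m ih =>
      intro a a' b b' h ha ha' hb hb'
      push_cast at ha ha' hb hb'
      refine dougall_of_shift_all h (ih _ _ _ _ ?_ ?_ ?_ ?_ ?_) <;>
        simp only [Complex.add_re, Complex.one_re] at * <;> linarith
  obtain ⟨m, hm⟩ := exists_nat_gt (max (max (1 - a.re) (1 - a'.re)) (max (1 - b.re) (1 - b'.re)))
  simp only [max_lt_iff] at hm
  exact key m _ _ _ _ h (by linarith) (by linarith) (by linarith) (by linarith)

/-- Dougall's bilateral summation formula. -/
theorem hasSum_kern {a a' b b' : ℂ} (h : 3 < (a + a' + b + b').re) :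
    HasSum (kern a a' b b') (dougallValue a a' b b') := by
  rw [← bilateralSum_eq_dougallValue h]
  exact (summable_kern h).hasSum

/-! ### Determinants with independent rows summed over the integers -/

lemma hasSum_prod_pi {n : ℕ} {f : Fin n → ℤ → ℂ} {s : Fin n → ℂ} (hf : ∀ i, HasSum (f i) (s i)) :
    HasSum (fun x : Fin n → ℤ => ∏ i, f i (x i)) (∏ i, s i) := by
  induction n with
  | zero => simp
  | succ n ih =>
    have h1 := ih fun i => hf i.succ
    set g : (Fin n → ℤ) → ℂ := fun x => ∏ i : Fin n, f i.succ (x i) with hg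
    have hs : Summable fun p : ℤ × (Fin n → ℤ) => f 0 p.1 * g p.2 :=
      summable_mul_of_summable_norm (hf 0).summable.norm h1.summable.norm
    have h2 : HasSum (fun p : ℤ × (Fin n → ℤ) => f 0 p.1 * g p.2) (s 0 * ∏ i : Fin n, s i.succ) :=
      (hf 0).mul h1 hs
    rw [← Fin.prod_univ_succ] at h2
    rw [← (Fin.consEquiv fun _ : Fin (n + 1) => ℤ).symm.hasSum_iff] at h2
    refine h2.congr_fun fun x => ?_
    rw [Fin.prod_univ_succ]
    rfl

/-- Row i depends on x_i alone, so each term of the permutation expansion is a product over separate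
variables. -/
lemma hasSum_det {n : ℕ} {A : Fin n → Fin n → ℤ → ℂ} {S : Fin n → Fin n → ℂ}
    (h : ∀ i j, HasSum (A i j) (S i j)) :
    HasSum (fun x : Fin n → ℤ => (Matrix.of fun i j => A i j (x i)).det) (Matrix.of S).det := by
  rw [← Matrix.det_transpose, Matrix.det_apply']
  simp_rw [← Matrix.det_transpose (Matrix.of fun i j => A i j _), Matrix.det_apply']
  exact hasSum_sum fun σ _ => (hasSum_prod_pi fun i => h i (σ i)).mul_left _

/-- Subtracting from every row its predecessor does not change the determinant. -/
lemma det_row_sub_pred {R : Type*} [CommRing R] {n : ℕ}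
    (A : Matrix (Fin (n + 1)) (Fin (n + 1)) R) :
    (Matrix.of (Fin.cons (A 0) fun i : Fin n => A i.succ - A i.castSucc)).det = A.det := by
  refine (Matrix.det_eq_of_forall_row_eq_smul_add_pred (fun _ => 1) (fun j => ?_)
    fun i j => ?_).symm <;> simp

/-- A determinant whose first column consists of ones, as a determinant of row differences. -/
lemma det_of_first_column_one {R : Type*} [CommRing R] {n : ℕ}
    (A : Matrix (Fin (n + 1)) (Fin (n + 1)) R) (h : ∀ i, A i 0 = 1) :
    A.det = (Matrix.of fun i j : Fin n => A i.succ j.succ - A i.castSucc j.succ).det := by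
  rw [← det_row_sub_pred, Matrix.det_succ_column_zero, Fin.sum_univ_succ, Finset.sum_eq_zero]
  · simp [h]
    rfl
  · intro i _
    simp [h]

/-- A determinant whose last row vanishes outside the first column. -/
lemma det_of_last_row {R : Type*} [CommRing R] {n : ℕ}
    (A : Matrix (Fin (n + 1)) (Fin (n + 1)) R) (h : ∀ j : Fin n, A (Fin.last n) j.succ = 0) :
    A.det = (-1) ^ n * A (Fin.last n) 0 *
      (Matrix.of fun i j : Fin n => A i.castSucc j.succ).det := by
  rw [Matrix.det_succ_row _ (Fin.last n), Fin.sum_univ_succ, Finset.sum_eq_zero]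
  · simp
    rfl
  · intro i _
    simp [h]

/-! ### Summation of the kernel against interlacing configurations -/

open Polynomial in
/-- The monic polynomial `∏_{j < k} (X + a' - 1 - j)`. -/
noncomputable def fallingPoly (a' : ℂ) (k : ℕ) : ℂ[X] :=
  ∏ j ∈ Finset.range k, (X - C (1 - a' + j))

lemma fallingPoly_monic (a' : ℂ) (k : ℕ) : (fallingPoly a' k).Monic :=
  Polynomial.monic_prod_X_sub_C _ _

lemma fallingPoly_natDegree (a' : ℂ) (k : ℕ) : (fallingPoly a' k).natDegree = k := by
  rw [fallingPoly, Polynomial.natDegree_finsetProd_X_sub_C_eq_card, Finset.card_range]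

/-- The shift trades the first factor for a new last one. Hence in the difference of lowered kernels
times `fallingPoly`, the polynomial factors out. -/
lemma fallingPoly_eval_sub_one (a' : ℂ) (k : ℕ) (x : ℂ) :
    (a' - 1 + x) * (fallingPoly a' k).eval (x - 1) =
      (a' - 1 - k + x) * (fallingPoly a' k).eval x := by
  induction k with
  | zero => simp [fallingPoly]
  | succ k ih =>
    have h : ∀ x : ℂ, (fallingPoly a' (k + 1)).eval x =
        (fallingPoly a' k).eval x * (x - (1 - a' + k)) := by
      intro x
      simp [fallingPoly, Finset.prod_range_succ]
    rw [h, h, ← mul_assoc, ih]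
    push_cast
    ring

open Polynomial in
/-- Monic polynomials such that the positive-degree ones integrate the kernel to
`kern a a' (b - 1) (b' - 1)` times a polynomial. -/
noncomputable def kernPoly (a a' b b' : ℂ) : ℕ → ℂ[X]
  | 0 => 1
  -- The linear factor is (b-1-x)(b'-1-x) - (a-1+x)(a'-1-k+x), whose x² terms cancel, made monic by
  -- dividing by -(a+a'+b+b'-4-k).
  | k + 1 => fallingPoly a' k * (X - C (((b - 1) * (b' - 1) - (a - 1) * (a' - 1 - k)) /
      (a + a' + b + b' - 4 - k)))

lemma kernPoly_monic (a a' b b' : ℂ) (k : ℕ) : (kernPoly a a' b b' k).Monic := by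
  cases k with
  | zero => exact Polynomial.monic_one
  | succ k => exact (fallingPoly_monic a' k).mul (Polynomial.monic_X_sub_C _)

lemma kernPoly_natDegree (a a' b b' : ℂ) (k : ℕ) : (kernPoly a a' b b' k).natDegree = k := by
  cases k with
  | zero => exact Polynomial.natDegree_one
  | succ k =>
    rw [kernPoly, (fallingPoly_monic a' k).natDegree_mul (Polynomial.monic_X_sub_C _),
      fallingPoly_natDegree, Polynomial.natDegree_X_sub_C]

lemma kern_mul_kernPoly_succ {a a' b b' : ℂ} {k : ℕ} (h : a + a' + b + b' - 4 - k ≠ 0) (x : ℤ) :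
    kern a a' b b' x * (kernPoly a a' b b' (k + 1)).eval (x : ℂ) =
      -(a + a' + b + b' - 4 - k)⁻¹ *
        (kern a a' (b - 1) (b' - 1) x * (fallingPoly a' k).eval (x : ℂ) -
          kern a a' (b - 1) (b' - 1) (x - 1) * (fallingPoly a' k).eval ((x - 1 : ℤ) : ℂ)) := by
  have h2 := fallingPoly_eval_sub_one a' k x
  rw [kern_sub_one, kern_sub_one_sub_one, kernPoly]
  push_cast
  simp only [Polynomial.eval_mul, Polynomial.eval_sub, Polynomial.eval_X, Polynomial.eval_C]
  rw [← sub_eq_zero]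
  field_simp
  linear_combination -(kern a a' b b' x) * (a - 1 + x) * h2

lemma kern_mul_eval_eq_sum (a a' b b' : ℂ) (p : Polynomial ℂ) (x : ℤ) :
    kern a a' b b' x * p.eval (x : ℂ) =
      ∑ i ∈ Finset.range (p.natDegree + 1), p.coeff i * (kern a a' b b' x * (x : ℂ) ^ i) := by
  rw [Polynomial.eval_eq_sum_range, Finset.mul_sum]
  exact Finset.sum_congr rfl fun i _ => by ring

lemma natCast_le_of_mem_range_succ {i d : ℕ} (hi : i ∈ Finset.range (d + 1)) : (i : ℝ) ≤ d := by
  exact_mod_cast Nat.lt_succ_iff.mp (Finset.mem_range.mp hi)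

lemma summable_kern_mul_eval {a a' b b' : ℂ} {p : Polynomial ℂ}
    (h : p.natDegree + 3 < (a + a' + b + b').re) :
    Summable fun x : ℤ => kern a a' b b' x * p.eval (x : ℂ) := by
  simp only [kern_mul_eval_eq_sum]
  refine summable_sum fun i hi => (summable_kern_mul_pow ?_).mul_left _
  linarith [natCast_le_of_mem_range_succ hi]

lemma tendsto_kern_mul_eval_atTop {a a' b b' : ℂ} {p : Polynomial ℂ}
    (h : p.natDegree + 2 < (a + a' + b + b').re) :
    Tendsto (fun x : ℤ => kern a a' b b' x * p.eval (x : ℂ)) atTop (𝓝 0) := by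
  simp only [kern_mul_eval_eq_sum]
  rw [← Finset.sum_const_zero (s := Finset.range (p.natDegree + 1))]
  refine tendsto_finsetSum _ fun i hi => ?_
  rw [← mul_zero (p.coeff i)]
  refine (tendsto_kern_mul_pow_atTop ?_).const_mul _
  linarith [natCast_le_of_mem_range_succ hi]

lemma tendsto_kern_mul_eval_atBot {a a' b b' : ℂ} {p : Polynomial ℂ}
    (h : p.natDegree + 2 < (a + a' + b + b').re) :
    Tendsto (fun x : ℤ => kern a a' b b' x * p.eval (x : ℂ)) atBot (𝓝 0) := by
  simp only [kern_mul_eval_eq_sum]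
  rw [← Finset.sum_const_zero (s := Finset.range (p.natDegree + 1))]
  refine tendsto_finsetSum _ fun i hi => ?_
  rw [← mul_zero (p.coeff i)]
  refine (tendsto_kern_mul_pow_atBot ?_).const_mul _
  linarith [natCast_le_of_mem_range_succ hi]

section Telescoping

variable {a a' b b' : ℂ} {k : ℕ}

lemma sub_natCast_ne_zero_of_lt_re (h : k + 4 < (a + a' + b + b').re) :
    a + a' + b + b' - 4 - k ≠ 0 := by
  intro h0
  have := congrArg Complex.re h0
  simp at this h
  linarith

/-- The decay estimates do not make the two terms summable separately under this hypothesis; the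
difference gains one order through the identity with `kernPoly`. -/
lemma summable_fallingPoly_sub (h : k + 4 < (a + a' + b + b').re) :
    Summable fun x : ℤ => kern a a' (b - 1) (b' - 1) x * (fallingPoly a' k).eval (x : ℂ) -
      kern a a' (b - 1) (b' - 1) (x - 1) * (fallingPoly a' k).eval ((x - 1 : ℤ) : ℂ) := by
  have h0 := sub_natCast_ne_zero_of_lt_re h
  have hs := summable_kern_mul_eval (a := a) (a' := a') (b := b) (b' := b')
    (p := kernPoly a a' b b' (k + 1)) (by rw [kernPoly_natDegree]; push_cast; linarith)
  simp only [kern_mul_kernPoly_succ h0] at hs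
  exact (summable_mul_left_iff (neg_ne_zero.mpr (inv_ne_zero h0))).mp hs

lemma fallingPoly_natDegree_add_two_lt (h : k + 4 < (a + a' + b + b').re) :
    (fallingPoly a' k).natDegree + 2 < (a + a' + (b - 1) + (b' - 1)).re := by
  rw [fallingPoly_natDegree]
  simp at h ⊢
  linarith

lemma hasSum_kern_mul_kernPoly_Iic (h : k + 4 < (a + a' + b + b').re) (y : ℤ) :
    HasSum ((Set.Iic y).indicator fun x : ℤ =>
        kern a a' b b' x * (kernPoly a a' b b' (k + 1)).eval (x : ℂ))
      (-(a + a' + b + b' - 4 - k)⁻¹ *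
        (kern a a' (b - 1) (b' - 1) y * (fallingPoly a' k).eval (y : ℂ))) := by
  have h0 := sub_natCast_ne_zero_of_lt_re h
  have := (hasSum_indicator_Iic_sub
    (g := fun x : ℤ => kern a a' (b - 1) (b' - 1) x * (fallingPoly a' k).eval (x : ℂ))
    (summable_fallingPoly_sub h)
    (tendsto_kern_mul_eval_atBot (fallingPoly_natDegree_add_two_lt h)) y).mul_left
      (-(a + a' + b + b' - 4 - k)⁻¹)
  simp only [kern_mul_kernPoly_succ h0]
  refine this.congr_fun fun x => ?_
  by_cases hx : x ∈ Set.Iic y <;> simp [hx]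

lemma hasSum_kern_mul_kernPoly (h : k + 4 < (a + a' + b + b').re) :
    HasSum (fun x : ℤ => kern a a' b b' x * (kernPoly a a' b b' (k + 1)).eval (x : ℂ)) 0 := by
  have h0 := sub_natCast_ne_zero_of_lt_re h
  have := (hasSum_sub_eq_zero
    (g := fun x : ℤ => kern a a' (b - 1) (b' - 1) x * (fallingPoly a' k).eval (x : ℂ))
    (summable_fallingPoly_sub h)
    (tendsto_kern_mul_eval_atBot (fallingPoly_natDegree_add_two_lt h))
    (tendsto_kern_mul_eval_atTop (fallingPoly_natDegree_add_two_lt h))).mul_left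
      (-(a + a' + b + b' - 4 - k)⁻¹)
  simp only [kern_mul_kernPoly_succ h0]
  simpa using this

end Telescoping

/-- The determinant `det (kern (x i) p_j (x i))` as a Vandermonde determinant. -/
lemma det_kern_mul_kernPoly (a a' b b' : ℂ) {n : ℕ} (x : Fin n → ℤ) :
    (Matrix.of fun i j : Fin n => kern a a' b b' (x i) *
      (kernPoly a a' b b' j).eval (x i : ℂ)).det =
      (∏ i, kern a a' b b' (x i)) * (Matrix.vandermonde fun i => (x i : ℂ)).det := by
  rw [Matrix.det_eval_matrixOfPolynomials_eq_det_vandermonde _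
    (fun j : Fin n => kernPoly a a' b b' j) (fun j => kernPoly_natDegree _ _ _ _ _)
    (fun j => kernPoly_monic _ _ _ _ _), ← Matrix.det_mul_column]
  rfl

/-- The sum of `∏ kern (x i)` times the Vandermonde determinant over all `x` interlacing with
a given configuration `y`. -/
theorem hasSum_interlacing {a a' b b' : ℂ} {n : ℕ} (h : n + 3 < (a + a' + b + b').re)
    {y : Fin n → ℤ} (hy : Monotone y) :
    HasSum ({x : Fin (n + 1) → ℤ | ∀ i : Fin n, x i.castSucc ≤ y i ∧ y i < x i.succ}.indicator
        fun x => (∏ i, kern a a' b b' (x i)) * (Matrix.vandermonde fun i => (x i : ℂ)).det)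
      (dougallValue a a' b b' * (∏ j : Fin n, (a + a' + b + b' - 4 - (j : ℕ))⁻¹) *
        ((∏ i, kern a a' (b - 1) (b' - 1) (y i)) *
          (Matrix.vandermonde fun i => (y i : ℂ)).det)) := by
  set f : Fin (n + 1) → ℤ → ℂ := fun j x =>
    kern a a' b b' x * (kernPoly a a' b b' j).eval (x : ℂ) with hf
  have hlt : ∀ j : Fin n, ((j : ℕ) : ℝ) + 4 < (a + a' + b + b').re := by
    intro j
    have : ((j : ℕ) : ℝ) + 1 ≤ n := by exact_mod_cast j.2
    linarith
  have hsum : ∀ j, Summable (f j) := by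
    intro j
    apply summable_kern_mul_eval
    rw [kernPoly_natDegree]
    have : ((j : ℕ) : ℝ) ≤ n := by exact_mod_cast Nat.lt_succ_iff.mp j.2
    linarith
  -- Nested half-lines ending in all of ℤ. The interlacing condition puts x_i in the successive
  -- difference `J i`, so the interval sums are row differences of the matrix `G` of cumulative
  -- sums.
  set U : Fin (n + 1) → Set ℤ := Fin.snoc (fun i => Set.Iic (y i)) Set.univ with hU
  have hUc : ∀ i : Fin n, U i.castSucc = Set.Iic (y i) := fun i => by simp [hU]
  have hUl : U (Fin.last n) = Set.univ := by simp [hU]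
  have hmono : ∀ i : Fin n, U i.castSucc ⊆ U i.succ := by
    intro i
    rw [hUc]
    rcases Fin.eq_castSucc_or_eq_last i.succ with ⟨j, hj⟩ | hj
    · rw [hj, hUc]
      refine Set.Iic_subset_Iic.mpr (hy ?_)
      have := congrArg Fin.val hj
      simp at this
      exact Fin.le_def.mpr (by omega)
    · rw [hj, hUl]
      exact Set.subset_univ _
  set G : Matrix (Fin (n + 1)) (Fin (n + 1)) ℂ :=
    Matrix.of fun i j => ∑' x, (U i).indicator (f j) x with hG
  have hGs : ∀ i j, HasSum ((U i).indicator (f j)) (G i j) := fun i j =>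
    ((hsum j).indicator _).hasSum
  set J : Fin (n + 1) → Set ℤ := Fin.cons (U 0) fun i : Fin n => U i.succ \ U i.castSucc with hJ
  have hrows : ∀ i j, HasSum ((J i).indicator (f j))
      ((Fin.cons (G 0) fun i : Fin n => G i.succ - G i.castSucc : Fin (n + 1) → _) i j) := by
    intro i j
    induction i using Fin.cases with
    | zero => simpa [hJ] using hGs 0 j
    | succ i =>
      simp only [hJ, Fin.cons_succ, Pi.sub_apply]
      rw [Set.indicator_sdiff (hmono i)]
      exact (hGs _ _).sub (hGs _ _)
  have hdet := hasSum_det hrows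
  rw [det_row_sub_pred, det_of_last_row] at hdet
  · convert hdet using 1
    · funext x
      have hmem : x ∈ {x : Fin (n + 1) → ℤ | ∀ i : Fin n, x i.castSucc ≤ y i ∧ y i < x i.succ} ↔
          ∀ i, x i ∈ J i := by
        rw [Fin.forall_fin_succ]
        simp only [hJ, Fin.cons_zero, Fin.cons_succ, Set.mem_sdiff, Set.mem_ofPred_eq]
        have h1 : (∀ i, x i ∈ U i) ↔ ∀ i : Fin n, x i.castSucc ≤ y i := by
          rw [Fin.forall_fin_succ']
          simp [hUc, hUl]
        rw [forall_and, forall_and, ← h1, Fin.forall_fin_succ, and_assoc]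
        simp [hUc]
      by_cases hx : ∀ i, x i ∈ J i
      · rw [Set.indicator_of_mem (hmem.mpr hx), ← det_kern_mul_kernPoly]
        congr 1
        ext i j
        simp [hx i, hf]
      · rw [Set.indicator_of_notMem (mt hmem.mp hx)]
        push Not at hx
        obtain ⟨i, hi⟩ := hx
        exact (Matrix.det_eq_zero_of_row_eq_zero i fun j => by simp [hi]).symm
    · have h00 : G (Fin.last n) 0 = dougallValue a a' b b' := by
        have h3 : 3 < (a + a' + b + b').re := by
          linarith [(Nat.cast_nonneg n : (0 : ℝ) ≤ n)]
        refine HasSum.unique (hGs _ _) ?_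
        simpa [hUl, hf, kernPoly] using hasSum_kern h3
      have hcol : ∀ i k : Fin n, G i.castSucc k.succ =
          -(a + a' + b + b' - 4 - (k : ℕ))⁻¹ * (kern a a' (b - 1) (b' - 1) (y i) *
            (fallingPoly a' k).eval (y i : ℂ)) := by
        intro i k
        refine HasSum.unique (hGs _ _) ?_
        rw [hUc]
        exact hasSum_kern_mul_kernPoly_Iic (hlt k) (y i)
      simp only [hcol]
      rw [h00]
      refine Eq.trans ?_ (congrArg _ (Matrix.det_mul_row (fun k : Fin n => -(a + a' + b + b' - 4 - (k : ℕ))⁻¹)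
        (Matrix.of fun i k : Fin n => kern a a' (b - 1) (b' - 1) (y i) *
            (fallingPoly a' k).eval (y i : ℂ)))).symm
      refine Eq.trans ?_ (congrArg (fun d => _ * (_ * d))
        (Matrix.det_mul_column (fun i : Fin n => kern a a' (b - 1) (b' - 1) (y i))
          (Matrix.of fun i k : Fin n => (fallingPoly a' k).eval (y i : ℂ)))).symm
      rw [← Matrix.det_eval_matrixOfPolynomials_eq_det_vandermonde _
          (fun k : Fin n => fallingPoly a' k) (fun j => fallingPoly_natDegree _ _)
          (fun j => fallingPoly_monic _ _), Finset.prod_neg]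
      rw [Finset.card_univ, Fintype.card_fin]
      -- One sign comes from expanding along the last row, the other from the n negated column
      -- factors.
      have : ((-1 : ℂ) ^ n) * (-1) ^ n = 1 := by rw [← mul_pow]; simp
      linear_combination (-(dougallValue a a' b b' *
        (∏ j : Fin n, (a + a' + b + b' - 4 - (j : ℕ))⁻¹) *
        ((∏ i, kern a a' (b - 1) (b' - 1) (y i)) *
          (Matrix.vandermonde fun i => (y i : ℂ)).det))) * this
  · intro k
    refine HasSum.unique (hGs _ _) ?_
    rw [hUl, Set.indicator_univ]
    exact hasSum_kern_mul_kernPoly (hlt k)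

lemma hasSum_indicator_Ico {f F : ℤ → ℂ} (h : ∀ t, F (t + 1) - F t = f t) {a b : ℤ}
    (hab : a ≤ b) : HasSum ((Set.Ico a b).indicator f) (F b - F a) := by
  induction b, hab using Int.leInduction with
  | base => simp
  | succ b hab ih =>
    have h1 := ih.add (hasSum_ite_eq b (f b))
    rw [← h, sub_add_sub_cancel'] at h1
    convert h1 using 2 with t
    rcases eq_or_ne t b with rfl | ht
    · simp [hab, h]
    · by_cases h2 : t ∈ Set.Ico a b
      · rw [Set.indicator_of_mem h2, Set.indicator_of_mem, if_neg ht, add_zero]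
        simp at h2 ⊢
        omega
      · rw [Set.indicator_of_notMem h2, Set.indicator_of_notMem, if_neg ht, add_zero]
        simp at h2 ⊢
        omega

/-- The sum of the Vandermonde determinant over all `y` interlacing with a given
configuration `x`. -/
theorem hasSum_vandermonde_interlacing {n : ℕ} {x : Fin (n + 1) → ℤ} (hx : Monotone x) :
    HasSum ({y : Fin n → ℤ | ∀ i : Fin n, x i.castSucc ≤ y i ∧ y i < x i.succ}.indicator
        fun y => (Matrix.vandermonde fun i => (y i : ℂ)).det)
      ((Matrix.vandermonde fun i => (x i : ℂ)).det / n.factorial) := by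
  -- Falling factorials satisfy ΔP_{j+1} = (j+1) P_j, so interval sums are differences of values.
  -- The factors 1/(j+1) multiply to 1/n!.
  set P : ℕ → Polynomial ℂ := fun k => descPochhammer ℂ k with hP
  have hmon : ∀ k, (P k).Monic := fun k => monic_descPochhammer ℂ k
  have hdeg : ∀ k, (P k).natDegree = k := fun k => descPochhammer_natDegree ℂ k
  have hstep : ∀ (k : ℕ) (t : ℂ), (P (k + 1)).eval (t + 1) - (P (k + 1)).eval t =
      (k + 1) * (P k).eval t := by
    intro k t
    have h := congrArg (Polynomial.eval (t + 1)) (descPochhammer_succ_comp_X_sub_one (R := ℂ) k)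
    simp [Polynomial.eval_comp] at h
    simp only [hP]
    linear_combination -h
  have hA : ∀ i j : Fin n, HasSum ((Set.Ico (x i.castSucc) (x i.succ)).indicator
      fun t : ℤ => (P j).eval (t : ℂ))
      (((j : ℕ) + 1 : ℂ)⁻¹ * ((P (j + 1)).eval (x i.succ : ℂ) -
        (P (j + 1)).eval (x i.castSucc : ℂ))) := by
    intro i j
    have hj : ((j : ℕ) : ℂ) + 1 ≠ 0 := Nat.cast_add_one_ne_zero _
    rw [mul_sub]
    refine hasSum_indicator_Ico
      (F := fun t : ℤ => ((j : ℕ) + 1 : ℂ)⁻¹ * (P (j + 1)).eval (t : ℂ)) (fun t => ?_)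
      (hx (Fin.castSucc_le_succ i))
    push_cast
    rw [← mul_sub, hstep, inv_mul_cancel_left₀ hj]
  have hdet := hasSum_det hA
  convert hdet using 1
  · funext y
    by_cases hy : ∀ i : Fin n, y i ∈ Set.Ico (x i.castSucc) (x i.succ)
    · rw [Set.indicator_of_mem (show y ∈ {y : Fin n → ℤ | ∀ i : Fin n, x i.castSucc ≤ y i ∧ y i < x i.succ}
        from hy),
        Matrix.det_eval_matrixOfPolynomials_eq_det_vandermonde _
          (fun k : Fin n => P k) (fun j => hdeg _) (fun j => hmon _)]
      congr 1
      ext i j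
      simp only [Matrix.of_apply]
      rw [Set.indicator_of_mem (hy i)]
    · rw [Set.indicator_of_notMem (show y ∉ {y : Fin n → ℤ | ∀ i : Fin n, x i.castSucc ≤ y i ∧ y i < x i.succ}
        from fun h => hy h)]
      push Not at hy
      obtain ⟨i, hi⟩ := hy
      exact (Matrix.det_eq_zero_of_row_eq_zero i fun j => by
        simp only [Matrix.of_apply]; rw [Set.indicator_of_notMem hi]).symm
  · refine Eq.trans ?_ (Matrix.det_mul_row (fun j : Fin n => ((j : ℕ) + 1 : ℂ)⁻¹)
      (Matrix.of fun i j : Fin n => (P (j + 1)).eval (x i.succ : ℂ) -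
        (P (j + 1)).eval (x i.castSucc : ℂ))).symm
    rw [Matrix.det_eval_matrixOfPolynomials_eq_det_vandermonde _
        (fun k : Fin (n + 1) => P k) (fun j => hdeg _) (fun j => hmon _),
      det_of_first_column_one _ (fun i => by simp [hP]), div_eq_inv_mul]
    congr 1
    rw [Finset.prod_inv_distrib, ← Finset.prod_range_add_one_eq_factorial,
      ← Fin.prod_univ_eq_prod_range (fun j => j + 1)]
    push_cast
    rfl

/-! ### Signatures as strictly increasing configurations -/

/-- The strictly increasing configuration `i ↦ i - ν_i` attached to a signature. -/
def coord {N : ℕ} (ν : Signature N) (i : Fin N) : ℤ := (i : ℕ) - ν.1 i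

lemma coord_strictMono {N : ℕ} (ν : Signature N) : StrictMono (coord ν) := by
  intro i j hij
  have h1 := ν.2 hij.le
  have h2 : (i : ℕ) < (j : ℕ) := hij
  unfold coord
  omega

lemma coord_injective (N : ℕ) : Function.Injective (coord : Signature N → Fin N → ℤ) := by
  intro ν μ h
  apply Subtype.ext
  funext i
  have := congrFun h i
  unfold coord at this
  omega

lemma exists_coord_eq {N : ℕ} {x : Fin N → ℤ} (hx : StrictMono x) :
    ∃ ν : Signature N, coord ν = x := by
  refine ⟨⟨fun i => (i : ℕ) - x i, ?_⟩, funext fun i => by simp [coord]⟩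
  cases N with
  | zero => exact fun i => i.elim0
  | succ n =>
    rw [Fin.antitone_iff_succ_le]
    intro i
    have := hx (Fin.castSucc_lt_succ (i := i))
    simp
    omega

/-- The coordinate at `i.succ` carries the index i + 1, which makes the second inequality strict. -/
lemma interlaced_iff_coord {N : ℕ} (lam : Signature N) (ν : Signature (N + 1)) :
    Interlaced lam ν ↔ ∀ i : Fin N, coord ν i.castSucc ≤ coord lam i ∧
      coord lam i < coord ν i.succ := by
  refine forall_congr' fun i => ?_
  simp [coord]
  omega

/-- The Vandermonde determinant of the configuration of a signature. -/
noncomputable def vand {N : ℕ} (x : Fin N → ℤ) : ℂ := (Matrix.vandermonde fun i => (x i : ℂ)).det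

/-- The Vandermonde determinant of `0, 1, …, N - 1`. -/
noncomputable def vandBase (N : ℕ) : ℂ := (Matrix.vandermonde fun i : Fin N => ((i : ℕ) : ℂ)).det

lemma vandBase_ne_zero (N : ℕ) : vandBase N ≠ 0 := by
  rw [vandBase, Matrix.det_vandermonde_ne_zero_iff]
  exact fun i j h => Fin.ext (Nat.cast_injective h)

lemma vandBase_succ (n : ℕ) : vandBase (n + 1) = n.factorial * vandBase n := by
  cases n with
  | zero => simp [vandBase]
  | succ n =>
    unfold vandBase
    rw [Matrix.det_vandermonde_id_eq_superFactorial, Matrix.det_vandermonde_id_eq_superFactorial,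
      Nat.superFactorial]
    push_cast
    rfl

lemma ofReal_dim {N : ℕ} (ν : Signature N) : ((dim ν : ℝ) : ℂ) = vand (coord ν) / vandBase N := by
  unfold dim vand vandBase
  rw [Matrix.det_vandermonde, Matrix.det_vandermonde]
  push_cast
  rw [← Finset.prod_div_distrib]
  refine Finset.prod_congr rfl fun i _ => ?_
  rw [← Finset.prod_div_distrib]
  refine Finset.prod_congr rfl fun j _ => ?_
  congr 1
  simp only [coord]
  push_cast
  ring

lemma dim_pos {N : ℕ} (ν : Signature N) : 0 < dim ν := by
  refine Finset.prod_pos fun i _ => Finset.prod_pos fun j hj => ?_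
  have hij := Finset.mem_Ioi.mp hj
  have h1 : ((ν.1 j : ℤ) : ℝ) ≤ ν.1 i := by exact_mod_cast ν.2 hij.le
  have h2 : ((i : ℕ) : ℝ) < (j : ℕ) := by exact_mod_cast hij
  apply div_pos <;> linarith

lemma vand_coord {N : ℕ} (ν : Signature N) : vand (coord ν) = dim ν * vandBase N := by
  rw [ofReal_dim, div_mul_cancel₀ _ (vandBase_ne_zero N)]

lemma link_nonneg {N : ℕ} (ν : Signature (N + 1)) (lam : Signature N) : 0 ≤ link ν lam := by
  unfold link
  split_ifs
  · exact div_nonneg (dim_pos _).le (dim_pos _).le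
  · exact le_rfl

/-- This is the branching rule ∑ dim λ = dim ν over λ ≺ ν; `vandBase_succ` absorbs the n!. -/
lemma hasSum_link {n : ℕ} (ν : Signature (n + 1)) : HasSum (fun lam => link ν lam) 1 := by
  have h := hasSum_vandermonde_interlacing (coord_strictMono ν).monotone
  rw [← (coord_injective n).hasSum_iff] at h
  · have h := h.div_const (vandBase n * dim ν)
    have hd : ((dim ν : ℝ) : ℂ) ≠ 0 := Complex.ofReal_ne_zero.mpr (dim_pos ν).ne'
    have hf : (n.factorial : ℂ) ≠ 0 := Nat.cast_ne_zero.mpr n.factorial_ne_zero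
    have hv := vandBase_ne_zero n
    have e := vand_coord ν
    rw [vandBase_succ] at e
    unfold vand at e
    rw [e, show (dim ν : ℂ) * (n.factorial * vandBase n) / n.factorial / (vandBase n * dim ν) = 1
      by field_simp] at h
    have hmem : ∀ lam : Signature n, Interlaced lam ν ↔ coord lam ∈ {y : Fin n → ℤ |
        ∀ i : Fin n, coord ν i.castSucc ≤ y i ∧ y i < coord ν i.succ} :=
      fun lam => interlaced_iff_coord lam ν
    rw [← Complex.hasSum_ofReal, Complex.ofReal_one]
    refine h.congr_fun fun lam => ?_
    by_cases hl : Interlaced lam ν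
    · rw [link, if_pos hl, Function.comp, Set.indicator_of_mem ((hmem lam).mp hl)]
      have e2 := vand_coord lam
      unfold vand at e2
      rw [e2]
      push_cast
      field_simp
    · rw [link, if_neg hl, Function.comp, Set.indicator_of_notMem
        (mt (hmem lam).mpr hl)]
      simp
  -- Interlacing with a strictly increasing configuration forces y to increase strictly, so only
  -- signatures contribute.
  · intro y hy
    refine Set.indicator_of_notMem (fun h => hy ?_) _
    have h : ∀ i : Fin n, coord ν i.castSucc ≤ y i ∧ y i < coord ν i.succ := h
    refine exists_coord_eq fun i j hij => ?_
    have hle : i.succ ≤ j.castSucc := by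
      rw [Fin.le_def]
      simpa using hij
    exact (h i).2.trans_le (((coord_strictMono ν).monotone hle).trans (h j).1)

/-! ### The zw-weights -/

/-- Passing from N to N - 1 lowers only the last two kernel parameters, each by 1, as in
`hasSum_interlacing`. -/
lemma zwWeight'_eq (z z' w w' : ℂ) (N : ℕ) (ν : Signature N) :
    zwWeight' z z' w w' N ν =
      (∏ i, kern (z + 1) (z' + 1) (w + N) (w' + N) (coord ν i)) * ((dim ν : ℝ) : ℂ) ^ 2 := by
  unfold zwWeight'
  congr 1
  refine Finset.prod_congr rfl fun i _ => ?_
  simp only [kern, coord, one_div, mul_inv]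
  push_cast
  rw [show z - (ν.1 i : ℂ) + ((i : ℕ) + 1) = z + 1 + ((i : ℕ) - (ν.1 i : ℂ)) by ring,
    show z' - (ν.1 i : ℂ) + ((i : ℕ) + 1) = z' + 1 + ((i : ℕ) - (ν.1 i : ℂ)) by ring,
    show w + N + 1 + (ν.1 i : ℂ) - ((i : ℕ) + 1) = w + N - ((i : ℕ) - (ν.1 i : ℂ)) by ring,
    show w' + N + 1 + (ν.1 i : ℂ) - ((i : ℕ) + 1) = w' + N - ((i : ℕ) - (ν.1 i : ℂ)) by ring]

/-- The ratio of two consecutive normalizing constants. -/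
noncomputable def zwRatio (z z' w w' : ℂ) (n : ℕ) : ℂ :=
  Complex.Gamma (z + z' + w + w' + ((n + 1 : ℕ) : ℂ)) /
    (Complex.Gamma (z + w + ((n + 1 : ℕ) : ℂ)) * Complex.Gamma (z + w' + ((n + 1 : ℕ) : ℂ)) *
      Complex.Gamma (z' + w + ((n + 1 : ℕ) : ℂ)) * Complex.Gamma (z' + w' + ((n + 1 : ℕ) : ℂ)) *
      Complex.Gamma ((n + 1 : ℕ) : ℂ))

lemma zwConst_succ (z z' w w' : ℂ) (n : ℕ) :
    zwConst z z' w w' (n + 1) = zwConst z z' w w' n * zwRatio z z' w w' n := by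
  unfold zwConst
  rw [Finset.prod_Icc_succ_top (by omega)]
  rfl

/-- With σ = z + z' + w + w', Dougall's numerator is Γ(σ + 2n + 1); the n inverse factors run from σ
+ n + 1 to σ + 2n and reduce it to Γ(σ + n + 1). -/
lemma zwRatio_eq {z z' w w' : ℂ} (h : -1 < (z + z' + w + w').re) (n : ℕ) :
    zwRatio z z' w w' n =
      dougallValue (z + 1) (z' + 1) (w + (n + 1 : ℕ)) (w' + (n + 1 : ℕ)) *
        (∏ j : Fin n, (z + 1 + (z' + 1) + (w + (n + 1 : ℕ)) + (w' + (n + 1 : ℕ)) - 4 -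
          (j : ℕ))⁻¹) / n.factorial := by
  have hre : 0 < (z + z' + w + w' + (n + 1 : ℕ)).re := by
    rw [Complex.add_re, Complex.natCast_re]
    push_cast
    linarith [(Nat.cast_nonneg n : (0 : ℝ) ≤ n)]
  have hne : ∀ m : ℕ, z + z' + w + w' + (n + 1 : ℕ) ≠ -m := by
    intro m hm
    rw [hm] at hre
    simp at hre
    linarith [(Nat.cast_nonneg m : (0 : ℝ) ≤ m)]
  have hG := Gamma_add_natCast_succ _ hne n
  have hprod : ∏ j : Fin n, (z + 1 + (z' + 1) + (w + (n + 1 : ℕ)) + (w' + (n + 1 : ℕ)) - 4 -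
      (j : ℕ)) = ∏ j ∈ Finset.range n, (z + z' + w + w' + (n + 1 : ℕ) + j) := by
    rw [Fin.prod_univ_eq_prod_range (fun j : ℕ => z + 1 + (z' + 1) + (w + (n + 1 : ℕ)) +
      (w' + (n + 1 : ℕ)) - 4 - (j : ℂ)) n, ← Finset.prod_range_reflect]
    refine Finset.prod_congr rfl fun j hj => ?_
    have hj' := Finset.mem_range.mp hj
    rw [Nat.cast_sub (by omega), Nat.cast_sub (by omega)]
    push_cast
    ring
  have hp0 : ∏ j ∈ Finset.range n, (z + z' + w + w' + (n + 1 : ℕ) + j) ≠ 0 :=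
    Finset.prod_ne_zero_iff.mpr fun j _ h0 => hne j (eq_neg_of_add_eq_zero_left h0)
  rw [Finset.prod_inv_distrib, hprod]
  unfold zwRatio dougallValue
  rw [show z + 1 + (z' + 1) + (w + (n + 1 : ℕ)) + (w' + (n + 1 : ℕ)) - 3 =
      z + z' + w + w' + (n + 1 : ℕ) + n by push_cast; ring, hG,
    show z + 1 + (w + (n + 1 : ℕ)) - 1 = z + w + (n + 1 : ℕ) by ring,
    show z + 1 + (w' + (n + 1 : ℕ)) - 1 = z + w' + (n + 1 : ℕ) by ring,
    show z' + 1 + (w + (n + 1 : ℕ)) - 1 = z' + w + (n + 1 : ℕ) by ring,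
    show z' + 1 + (w' + (n + 1 : ℕ)) - 1 = z' + w' + (n + 1 : ℕ) by ring]
  rw [show Complex.Gamma ((n + 1 : ℕ) : ℂ) = n.factorial by
    rw [Nat.cast_succ, Complex.Gamma_nat_eq_factorial]]
  simp only [div_eq_mul_inv, mul_inv]
  linear_combination (-(Complex.Gamma (z + z' + w + w' + (n + 1 : ℕ)) *
    (Complex.Gamma (z + w + (n + 1 : ℕ)))⁻¹ * (Complex.Gamma (z + w' + (n + 1 : ℕ)))⁻¹ *
    (Complex.Gamma (z' + w + (n + 1 : ℕ)))⁻¹ * (Complex.Gamma (z' + w' + (n + 1 : ℕ)))⁻¹ *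
    (n.factorial : ℂ)⁻¹)) * mul_inv_cancel₀ hp0

/-- The weights are transformed by the links into multiples of the weights one level below. -/
lemma hasSum_zwWeight'_mul_link {z z' w w' : ℂ} (h : -1 < (z + z' + w + w').re) {n : ℕ}
    (lam : Signature n) :
    HasSum (fun ν => zwWeight' z z' w w' (n + 1) ν * ((link ν lam : ℝ) : ℂ))
      (zwRatio z z' w w' n * zwWeight' z z' w w' n lam) := by
  have hre : (n : ℝ) + 3 <
      (z + 1 + (z' + 1) + (w + (n + 1 : ℕ)) + (w' + (n + 1 : ℕ))).re := by
    simp at h ⊢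
    linarith [(Nat.cast_nonneg n : (0 : ℝ) ≤ n)]
  have hs := hasSum_interlacing hre (coord_strictMono lam).monotone
  have hl : ((dim lam : ℝ) : ℂ) ≠ 0 := Complex.ofReal_ne_zero.mpr (dim_pos lam).ne'
  have hf : (n.factorial : ℂ) ≠ 0 := Nat.cast_ne_zero.mpr n.factorial_ne_zero
  have hv := vandBase_ne_zero n
  rw [← (coord_injective (n + 1)).hasSum_iff] at hs
  -- In (dim ν)² · dim λ / dim ν one factor dim ν is left, equal to its Vandermonde determinant over
  -- `vandBase (n + 1)`.
  · have hs := hs.mul_right (((dim lam : ℝ) : ℂ) / vandBase (n + 1))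
    have hmem : ∀ ν : Signature (n + 1), Interlaced lam ν ↔ coord ν ∈ {x : Fin (n + 1) → ℤ |
        ∀ i : Fin n, x i.castSucc ≤ coord lam i ∧ coord lam i < x i.succ} :=
      fun ν => interlaced_iff_coord lam ν
    refine Eq.subst (motive := fun v => HasSum (fun ν : Signature (n + 1) =>
      zwWeight' z z' w w' (n + 1) ν * ((link ν lam : ℝ) : ℂ)) v) ?_ (hs.congr_fun fun ν => ?_)
    · have e := vand_coord lam
      unfold vand at e
      rw [e, zwRatio_eq h, zwWeight'_eq, vandBase_succ,
        show w + ((n + 1 : ℕ) : ℂ) - 1 = w + n by push_cast; ring,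
        show w' + ((n + 1 : ℕ) : ℂ) - 1 = w' + n by push_cast; ring]
      field_simp
    · have hd : ((dim ν : ℝ) : ℂ) ≠ 0 := Complex.ofReal_ne_zero.mpr (dim_pos ν).ne'
      by_cases hi : Interlaced lam ν
      · rw [link, if_pos hi, Function.comp,
          Set.indicator_of_mem ((hmem ν).mp hi), zwWeight'_eq]
        have e := vand_coord ν
        unfold vand at e
        rw [e]
        have := vandBase_ne_zero (n + 1)
        push_cast
        field_simp
      · rw [link, if_neg hi, Function.comp, Set.indicator_of_notMem
          (mt (hmem ν).mpr hi)]
        simp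
  · intro x hx
    refine Set.indicator_of_notMem (fun h => hx ?_) _
    have h : ∀ i : Fin n, x i.castSucc ≤ coord lam i ∧ coord lam i < x i.succ := h
    exact exists_coord_eq (Fin.strictMono_iff_lt_succ.mpr fun i => (h i).1.trans_lt (h i).2)

/-! ### Positivity -/

/-- By the functional equation the value at k is a positive multiple of the value at k + 1, so large
k suffices. -/
lemma inv_Gamma_mul_inv_Gamma_pos {z z' : ℂ} (h : ∀ k : ℤ, 0 < (z + k) * (z' + k)) (k : ℤ) :
    0 < (Complex.Gamma (z + k))⁻¹ * (Complex.Gamma (z' + k))⁻¹ := by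
  have hdesc : ∀ m : ℕ, ∀ k : ℤ,
      0 < (Complex.Gamma (z + (k + m : ℤ)))⁻¹ * (Complex.Gamma (z' + (k + m : ℤ)))⁻¹ →
      0 < (Complex.Gamma (z + k))⁻¹ * (Complex.Gamma (z' + k))⁻¹ := by
    intro m
    induction m with
    | zero => intro k hk; simpa using hk
    | succ m ih =>
      intro k hk
      apply ih
      rw [Complex.one_div_Gamma_eq_self_mul_one_div_Gamma_add_one,
        Complex.one_div_Gamma_eq_self_mul_one_div_Gamma_add_one (z' + _), mul_mul_mul_comm]
      refine mul_pos (h _) ?_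
      convert hk using 4 <;> push_cast <;> ring
  obtain ⟨m, hm⟩ := exists_nat_gt (max (-z.re - k) (-z'.re - k))
  have hm1 := (le_max_left _ _).trans_lt hm
  have hm2 := (le_max_right _ _).trans_lt hm
  have hz : 0 < (z + (k + m : ℤ)).re := by simp; linarith
  have hz' : 0 < (z' + (k + m : ℤ)).re := by simp; linarith
  refine hdesc m k ?_
  generalize (k + m : ℤ) = l at hz hz'
  -- Reality of the products at 0 and 1 makes z + z' real; then z, z' are both real or complex
  -- conjugates.
  have h0 := (Complex.pos_iff.mp (h 0)).2
  have h1 := (Complex.pos_iff.mp (h 1)).2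
  simp at h0 h1
  have him : z'.im = -z.im := by linarith
  rcases eq_or_ne z.im 0 with hi | hi
  · have e : ∀ u : ℂ, u.im = 0 → 0 < (u + l).re → 0 < (Complex.Gamma (u + l))⁻¹ := by
      intro u hu hre
      have : u + l = (((u + l).re : ℝ) : ℂ) := by
        apply Complex.ext <;> simp [hu]
      rw [this, Complex.Gamma_ofReal, ← Complex.ofReal_inv]
      exact Complex.zero_lt_real.mpr (inv_pos.mpr (Real.Gamma_pos_of_pos hre))
    exact mul_pos (e z hi hz) (e z' (by rw [him, hi, neg_zero]) hz')
  · have hre : z'.re = z.re := by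
      rw [him] at h0
      have : z.im * (z'.re - z.re) = 0 := by linarith
      rcases mul_eq_zero.mp this with h | h
      · exact absurd h hi
      · linarith
    have hc : z' + l = starRingEnd ℂ (z + l) := by
      apply Complex.ext <;> simp [him, hre]
    rw [hc, Complex.Gamma_conj, ← mul_inv, Complex.mul_conj, ← Complex.ofReal_inv]
    exact Complex.zero_lt_real.mpr
      (inv_pos.mpr (Complex.normSq_pos.mpr (Complex.Gamma_ne_zero_of_re_pos hz)))

lemma zwWeight'_pos {z z' w w' : ℂ} (h : Admissible z z' w w') (N : ℕ) (ν : Signature N) :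
    0 < zwWeight' z z' w w' N ν := by
  rw [zwWeight'_eq]
  refine mul_pos (Finset.prod_pos fun i _ => mul_pos ?_ ?_) ?_
  · have := inv_Gamma_mul_inv_Gamma_pos h.pos_z (1 + coord ν i)
    push_cast at this
    simpa only [add_assoc] using this
  · have := inv_Gamma_mul_inv_Gamma_pos h.pos_w (N - coord ν i)
    push_cast at this
    simpa only [add_sub_assoc] using this
  · rw [← Complex.ofReal_pow]
    exact Complex.zero_lt_real.mpr (pow_pos (dim_pos ν) 2)

lemma ofReal_re_zwWeight' {z z' w w' : ℂ} (h : Admissible z z' w w') (N : ℕ) (ν : Signature N) :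
    (((zwWeight' z z' w w' N ν).re : ℝ) : ℂ) = zwWeight' z z' w w' N ν :=
  Complex.ext rfl (Complex.pos_iff.mp (zwWeight'_pos h N ν)).2

lemma re_zwWeight'_pos {z z' w w' : ℂ} (h : Admissible z z' w w') (N : ℕ) (ν : Signature N) :
    0 < (zwWeight' z z' w w' N ν).re :=
  (Complex.pos_iff.mp (zwWeight'_pos h N ν)).1

instance (N : ℕ) : Inhabited (Signature N) := ⟨⟨fun _ => 0, antitone_const⟩⟩

/-- No analysis of the Γ-factors is needed: the ratio times a positive weight is a sum of
nonnegative reals. -/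
lemma zwRatio_re_im {z z' w w' : ℂ} (h : Admissible z z' w w') (n : ℕ) :
    ((zwRatio z z' w w' n).re : ℂ) = zwRatio z z' w w' n ∧ 0 ≤ (zwRatio z z' w w' n).re := by
  have hs := hasSum_zwWeight'_mul_link h.re_sum (default : Signature n)
  rw [← ofReal_re_zwWeight' h n default] at hs
  have hpos := re_zwWeight'_pos h n default
  have him := hs.mapL Complex.imCLM
  have hre := hs.mapL Complex.reCLM
  simp only [Complex.imCLM_apply, Complex.reCLM_apply, Complex.im_mul_ofReal,
    Complex.re_mul_ofReal, ← (Complex.pos_iff.mp (zwWeight'_pos h _ _)).2, zero_mul] at him hre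
  refine ⟨Complex.ext rfl ?_, ?_⟩
  · have := him.unique hasSum_zero
    rw [Complex.ofReal_im]
    exact ((mul_eq_zero.mp this).resolve_right hpos.ne').symm
  · have := hre.nonneg fun ν =>
      mul_nonneg (re_zwWeight'_pos h _ ν).le (link_nonneg ν default)
    exact nonneg_of_mul_nonneg_left this hpos

lemma hasSum_re_zwWeight'_mul_link {z z' w w' : ℂ} (h : Admissible z z' w w') {n : ℕ}
    (lam : Signature n) :
    HasSum (fun ν => (zwWeight' z z' w w' (n + 1) ν).re * link ν lam)
      ((zwRatio z z' w w' n).re * (zwWeight' z z' w w' n lam).re) := by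
  rw [← Complex.hasSum_ofReal]
  push_cast
  rw [(zwRatio_re_im h n).1, ofReal_re_zwWeight' h]
  simp only [ofReal_re_zwWeight' h]
  exact hasSum_zwWeight'_mul_link h.re_sum lam

/-- Insert ∑ link = 1 and exchange the sums; in `ℝ≥0∞` this requires no prior summability of the
weights. -/
lemma tsum_ofReal_zwWeight'_succ {z z' w w' : ℂ} (h : Admissible z z' w w') (n : ℕ) :
    ∑' ν, ENNReal.ofReal (zwWeight' z z' w w' (n + 1) ν).re =
      ENNReal.ofReal (zwRatio z z' w w' n).re *
        ∑' lam, ENNReal.ofReal (zwWeight' z z' w w' n lam).re := by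
  have h1 : ∀ ν : Signature (n + 1), ∑' lam, ENNReal.ofReal (link ν lam) = 1 := by
    intro ν
    rw [← ENNReal.ofReal_tsum_of_nonneg (link_nonneg ν) (hasSum_link ν).summable,
      (hasSum_link ν).tsum_eq, ENNReal.ofReal_one]
  calc _ = ∑' ν, ∑' lam, ENNReal.ofReal (zwWeight' z z' w w' (n + 1) ν).re *
        ENNReal.ofReal (link ν lam) := by
        simp_rw [ENNReal.tsum_mul_left, h1, mul_one]
    _ = ∑' lam, ∑' ν, ENNReal.ofReal (zwWeight' z z' w w' (n + 1) ν).re *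
        ENNReal.ofReal (link ν lam) := ENNReal.tsum_comm
    _ = _ := by
        rw [← ENNReal.tsum_mul_left]
        refine tsum_congr fun lam => ?_
        have hs := hasSum_re_zwWeight'_mul_link h lam
        simp_rw [← ENNReal.ofReal_mul (re_zwWeight'_pos h _ _).le]
        rw [← ENNReal.ofReal_tsum_of_nonneg (fun ν => mul_nonneg (re_zwWeight'_pos h _ ν).le
          (link_nonneg ν lam)) hs.summable, hs.tsum_eq,
          ENNReal.ofReal_mul (zwRatio_re_im h n).2]

lemma tsum_ofReal_zwWeight' {z z' w w' : ℂ} (h : Admissible z z' w w') (N : ℕ) :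
    ((zwConst z z' w w' N).re : ℂ) = zwConst z z' w w' N ∧ 0 ≤ (zwConst z z' w w' N).re ∧
      ∑' ν, ENNReal.ofReal (zwWeight' z z' w w' N ν).re =
        ENNReal.ofReal (zwConst z z' w w' N).re := by
  induction N with
  | zero =>
    -- The induction starts at the empty signature, where weight and constant are both 1.
    have : Unique (Signature 0) := ⟨inferInstance, fun ν => Subtype.ext (funext fun i => i.elim0)⟩
    simp [zwConst, tsum_fintype, zwWeight', dim]
  | succ n ih =>
    obtain ⟨i1, i2, i3⟩ := ih
    obtain ⟨r1, r2⟩ := zwRatio_re_im h n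
    have e : zwConst z z' w w' (n + 1) =
        (((zwConst z z' w w' n).re * (zwRatio z z' w w' n).re : ℝ) : ℂ) := by
      rw [zwConst_succ, Complex.ofReal_mul, i1, r1]
    rw [tsum_ofReal_zwWeight'_succ h, i3, e, Complex.ofReal_re, ENNReal.ofReal_mul i2, mul_comm]
    exact ⟨rfl, mul_nonneg r2 i2, mul_comm _ _⟩

lemma hasSum_re_zwWeight' {z z' w w' : ℂ} (h : Admissible z z' w w') (N : ℕ) :
    HasSum (fun ν => (zwWeight' z z' w w' N ν).re) (zwConst z z' w w' N).re := by
  obtain ⟨-, h2, h3⟩ := tsum_ofReal_zwWeight' h N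
  have hs := ENNReal.hasSum_toReal (h3 ▸ ENNReal.ofReal_ne_top)
  rw [← ENNReal.tsum_toReal_eq fun _ => ENNReal.ofReal_ne_top, h3,
    ENNReal.toReal_ofReal h2] at hs
  simpa only [ENNReal.toReal_ofReal (re_zwWeight'_pos h N _).le] using hs

lemma re_zwConst_pos {z z' w w' : ℂ} (h : Admissible z z' w w') (N : ℕ) :
    0 < (zwConst z z' w w' N).re := by
  rw [← (hasSum_re_zwWeight' h N).tsum_eq]
  exact (hasSum_re_zwWeight' h N).summable.tsum_pos (fun ν => (re_zwWeight'_pos h N ν).le) default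
    (re_zwWeight'_pos h N default)

/-- The zw-measure on signatures of length `N`. -/
noncomputable def zwMeasure {z z' w w' : ℂ} (h : Admissible z z' w w') (N : ℕ) :
    PMF (Signature N) :=
  ⟨fun ν => ENNReal.ofReal ((zwWeight' z z' w w' N ν).re / (zwConst z z' w w' N).re), by
    have hs := (hasSum_re_zwWeight' h N).div_const (zwConst z z' w w' N).re
    rw [div_self (re_zwConst_pos h N).ne'] at hs
    convert ENNReal.summable.hasSum using 1
    rw [← ENNReal.ofReal_tsum_of_nonneg (fun ν =>
      div_nonneg (re_zwWeight'_pos h N ν).le (re_zwConst_pos h N).le) hs.summable, hs.tsum_eq,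
      ENNReal.ofReal_one]⟩

lemma zwMeasure_apply {z z' w w' : ℂ} (h : Admissible z z' w w') (N : ℕ) (ν : Signature N) :
    zwMeasure h N ν =
      ENNReal.ofReal ((zwWeight' z z' w w' N ν).re / (zwConst z z' w w' N).re) := rfl

lemma isCoherent_zwMeasure {z z' w w' : ℂ} (h : Admissible z z' w w') :
    IsCoherent (zwMeasure h) := by
  intro n _ lam
  have hnn : ∀ ν : Signature (n + 1),
      0 ≤ (zwWeight' z z' w w' (n + 1) ν).re / (zwConst z z' w w' (n + 1)).re := fun ν =>
    div_nonneg (re_zwWeight'_pos h _ ν).le (re_zwConst_pos h _).le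
  have hs := (hasSum_re_zwWeight'_mul_link h lam).div_const (zwConst z z' w w' (n + 1)).re
  simp only [mul_div_right_comm] at hs
  simp only [compLink, zwMeasure_apply, ← ENNReal.ofReal_mul (hnn _)]
  rw [← ENNReal.ofReal_tsum_of_nonneg (fun ν => mul_nonneg (hnn ν) (link_nonneg ν lam))
    hs.summable, hs.tsum_eq]
  congr 1
  have e : (zwConst z z' w w' (n + 1)).re =
      (zwConst z z' w w' n).re * (zwRatio z z' w w' n).re := by
    rw [zwConst_succ, ← (tsum_ofReal_zwWeight' h n).1, ← (zwRatio_re_im h n).1,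
      ← Complex.ofReal_mul]
    simp only [Complex.ofReal_re]
  have h1 := re_zwConst_pos h (n + 1)
  have h2 := re_zwConst_pos h n
  rw [e] at h1 ⊢
  have h3 : (zwRatio z z' w w' n).re ≠ 0 := fun h0 => by simp [h0] at h1
  field_simp

end ZW

theorem theorem4 (z z' w w' : ℂ) (h : ZW.Admissible z z' w w') :
    (∀ N : ℕ, 1 ≤ N →
      (∀ ν : ZW.Signature N, 0 < ZW.zwWeight' z z' w w' N ν) ∧
      HasSum (fun ν : ZW.Signature N => ZW.zwWeight' z z' w w' N ν) (ZW.zwConst z z' w w' N)) ∧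
    ∃ M : (N : ℕ) → PMF (ZW.Signature N),
      (∀ N : ℕ, 1 ≤ N → ∀ ν : ZW.Signature N,
        (((M N ν).toReal : ℝ) : ℂ) = ZW.zwWeight z z' w w' N ν) ∧
      ZW.IsCoherent M := by
  refine ⟨fun N _ => ⟨ZW.zwWeight'_pos h N, ?_⟩, ZW.zwMeasure h, fun N _ ν => ?_,
    ZW.isCoherent_zwMeasure h⟩
  · have hs := Complex.hasSum_ofReal.mpr (ZW.hasSum_re_zwWeight' h N)
    simpa only [ZW.ofReal_re_zwWeight' h, (ZW.tsum_ofReal_zwWeight' h N).1] using hs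
  · rw [ZW.zwMeasure_apply, ENNReal.toReal_ofReal (div_nonneg (ZW.re_zwWeight'_pos h N ν).le
      (ZW.re_zwConst_pos h N).le), Complex.ofReal_div, ZW.ofReal_re_zwWeight' h,
      (ZW.tsum_ofReal_zwWeight' h N).1, ZW.zwWeight]
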